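/- **Conventions.** A *correspondence* from a $C^*$-algebra $A$ to a $C^*$-algebra $B$ is a (right) Hilbert $B$-module $\mathcal{E}$ with a $*$-homomorphism $\varphi_{\mathcal{E}}\colon A\to\mathbb{B}(\mathcal{E})$ to the adjointable operators that is nondegenerate: $\varphi_{\mathcal{E}}(A)\mathcal{E}$ spans a dense subspace of $\mathcal{E}$. It is *proper* if $\varphi_{\mathcal{E}}(A)\subseteq\mathbb{K}(\mathcal{E})$, the closed linear span of the operators $|\xi\rangle\langle\eta|\colon\zeta\mapsto\xi\langle\eta,\zeta\rangle$. An isomorphism of correspondences is a bimodule map that is unitary for the inner products. Let $\mathcal{E}\colon A\to B_1$, $\mathcal{F}_1\colon B_1\to B_2$ and $\mathcal{F}_2\colon A\to B_2$ be correspondences. A *representation* of $\mathcal{E}$ is a linear map $S\colon\mathcal{E}\to\mathbb{B}(\mathcal{F}_1,\mathcal{F}_2)$ with $S(a\xi)=aS(\xi)$ and $S(\xi)^*S(\eta)=\langle\xi,\eta\rangle$ for all $a\in A$, $\xi,\eta\in\mathcal{E}$. It is *nondegenerate* if $S(\mathcal{E})\mathcal{F}_1$ spans a dense subspace of $\mathcal{F}_2$.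 It is *Cuntz–Pimsner covariant* if $\vartheta(\varphi_{\mathcal{E}}(a))=\varphi_{\mathcal{F}_2}(a)$ for all $a\in A$ with $\varphi_{\mathcal{E}}(a)\in\mathbb{K}(\mathcal{E})$, where $\vartheta\colon\mathbb{K}(\mathcal{E})\to\mathbb{B}(\mathcal{F}_2)$ is the $*$-homomorphism with $\vartheta(|\xi\rangle\langle\eta|)=S(\xi)S(\eta)^*$. **Proposition.** 1. Every nondegenerate representation of $\mathcal{E}$ is Cuntz–Pimsner covariant. If $\mathcal{E}$ is proper, then every Cuntz–Pimsner covariant representation of $\mathcal{E}$ is nondegenerate. 2. Let $\mathcal{E}$ be a proper correspondence from $A$ to itself. Its Cuntz–Pimsner algebra, that is, the universal $C^*$-algebra $\mathcal{O}$ with a $*$-homomorphism $\varphi_0\colon A\to\mathcal{O}$ and a linear map $S_0\colon\mathcal{E}\to\mathcal{O}$ that form a Cuntz–Pimsner covariant representation of $\mathcal{E}$ in a $C^*$-algebra, exists. A triple $(\mathcal{O},\varphi_0,S_0)$ is the Cuntz–Pimsner algebra of $\mathcal{E}$ if and only if it is universal for nondegenerate representations: $\mathcal{O}$, viewed as a Hilbert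 $\mathcal{O}$-module with $A$ acting through $\varphi_0$, is a correspondence on which $S_0$ is a nondegenerate representation of $\mathcal{E}$, and for every $C^*$-algebra $B$ and every Hilbert $B$-module $\mathcal{F}$, the map $\psi\mapsto(\psi\circ\varphi_0,\psi\circ S_0)$ is a bijection from nondegenerate $*$-homomorphisms $\psi\colon\mathcal{O}\to\mathbb{B}(\mathcal{F})$ to pairs of a nondegenerate $*$-homomorphism $\varphi\colon A\to\mathbb{B}(\mathcal{F})$ and a nondegenerate representation $\mathcal{E}\to\mathbb{B}(\mathcal{F})$ with respect to $\varphi$. 3. Equivalently, $\mathcal{O}$ is universal for transformations. Here a *transformation* from $(A,\mathcal{E})$ to a $C^*$-algebra $B$ is a correspondence $\mathcal{F}$ from $A$ to $B$ with an isomorphism of correspondences $u\colon\mathcal{E}\otimes_A\mathcal{F}\cong\mathcal{F}$. Explicitly: if $(\mathcal{O},\varphi_0,S_0)$ is the Cuntz–Pimsner algebra of the proper correspondence $\mathcal{E}$, then $u_0(\xi\otimes x)=S_0(\xi)x$ defines a transformation $u_0\colon\mathcal{E}\otimes_A\mathcal{O}\cong\mathcal{O}$ from $(A,\mathcal{E})$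 to $\mathcal{O}$ such that, for every $C^*$-algebra $B$ and every Hilbert $B$-module $\mathcal{F}$, the map $\psi\mapsto(\psi\circ\varphi_0,\,u_0\otimes_\psi\mathrm{id}_{\mathcal{F}})$ is a bijection from nondegenerate $*$-homomorphisms $\psi\colon\mathcal{O}\to\mathbb{B}(\mathcal{F})$ to transformations from $(A,\mathcal{E})$ to $B$ with underlying Hilbert module $\mathcal{F}$. Here $u_0\otimes_\psi\mathrm{id}_{\mathcal{F}}$ is the map $\xi\otimes\psi(x)\eta\mapsto\psi(u_0(\xi\otimes x))\eta$. Conversely, if $(\mathcal{O},\varphi_0,u_0)$ is a transformation with this universal property, then there is $S_0\colon\mathcal{E}\to\mathcal{O}$ with $u_0(\xi\otimes x)=S_0(\xi)x$, and $(\mathcal{O},\varphi_0,S_0)$ is the Cuntz–Pimsner algebra of $\mathcal{E}$. -/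

import Mathlib

open UniformSpace

universe u

set_option linter.unusedSectionVars false
noncomputable section
/-!
### Hilbert modules and adjointable operators

In Mathlib, `CStarModule R X` is a left `R`-module with an `R`-valued inner product that satisfies
`inner x (r • y) = r * inner x y`. A (right) Hilbert `B`-module is therefore a complete
`CStarModule Bᵐᵒᵖ F`: the right action is `x · b = MulOpposite.op b • x`, and the `B`-valued inner
product is `rinner B x y = (inner Bᵐᵒᵖ x y).unop`, with `rinner B x (y · b) = rinner B x y * b`.
-/
section
variable {R X : Type*} [NonUnitalCStarAlgebra R] [PartialOrder R] [StarOrderedRing R]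
  [NormedAddCommGroup X] [NormedSpace ℂ X] [SMul R X] [CStarModule R X]

namespace HilbertModule
theorem ext_inner {x y : X} (h : ∀ w : X, inner R w x = inner R w y) : x = y := by
  have h2 : inner R (x - y) (x - y) = 0 := by
    rw [CStarModule.inner_sub_right, h, sub_self]
  exact sub_eq_zero.mp (CStarModule.inner_self.mp h2)

theorem smul_add' (r : R) (x y : X) : r • (x + y) = r • x + r • y :=
  ext_inner (R := R) fun w => by simp [mul_add]

theorem add_smul' (r s : R) (x : X) : (r + s) • x = r • x + s • x :=
  ext_inner (R := R) fun w => by simp [add_mul]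

theorem smul_comm' (r : R) (z : ℂ) (x : X) : r • (z • x) = z • (r • x) :=
  ext_inner (R := R) fun w => by simp [mul_smul_comm]

theorem smul_assoc' (z : ℂ) (r : R) (x : X) : (z • r) • x = z • (r • x) :=
  ext_inner (R := R) fun w => by simp [smul_mul_assoc]

theorem mul_smul' (r s : R) (x : X) : (r * s) • x = r • (s • x) :=
  ext_inner (R := R) fun w => by simp [mul_assoc]

theorem norm_smul_le' (r : R) (x : X) : ‖r • x‖ ≤ ‖r‖ * ‖x‖ := by
  have h : ‖r • x‖ ^ 2 ≤ (‖r‖ * ‖x‖) ^ 2 := by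
    rw [CStarModule.norm_sq_eq R, mul_pow, CStarModule.norm_sq_eq (A := R) (x := x)]
    simp only [CStarModule.inner_op_smul_right, CStarModule.inner_op_smul_left]
    calc _ ≤ ‖r‖ * (‖inner R x x‖ * ‖star r‖) :=
          (norm_mul_le _ _).trans (by gcongr; exact norm_mul_le _ _)
      _ = _ := by rw [norm_star]; ring
  exact le_of_sq_le_sq h (by positivity)
end HilbertModule
end

/-- `𝔹(F, G)`: adjointable operators from the Hilbert `B`-module `F` to the Hilbert
`B`-module `G`. The adjoint is unique, so two such operators with the same underlying map are
equal, see `Adjointable.ext`. -/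
structure Adjointable (B F G : Type*) [NonUnitalCStarAlgebra B] [PartialOrder B]
    [StarOrderedRing B]
    [NormedAddCommGroup F] [NormedSpace ℂ F] [SMul Bᵐᵒᵖ F] [CStarModule Bᵐᵒᵖ F]
    [NormedAddCommGroup G] [NormedSpace ℂ G] [SMul Bᵐᵒᵖ G] [CStarModule Bᵐᵒᵖ G] where
  toCLM : F →L[ℂ] G
  adj : G →L[ℂ] F
  inner_adj : ∀ (x : F) (y : G), inner Bᵐᵒᵖ (adj y) x = inner Bᵐᵒᵖ y (toCLM x)

namespace Adjointable
variable {B F G H : Type*} [NonUnitalCStarAlgebra B] [PartialOrder B] [StarOrderedRing B]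
  [NormedAddCommGroup F] [NormedSpace ℂ F] [SMul Bᵐᵒᵖ F] [CStarModule Bᵐᵒᵖ F]
  [NormedAddCommGroup G] [NormedSpace ℂ G] [SMul Bᵐᵒᵖ G] [CStarModule Bᵐᵒᵖ G]
  [NormedAddCommGroup H] [NormedSpace ℂ H] [SMul Bᵐᵒᵖ H] [CStarModule Bᵐᵒᵖ H]

instance : CoeFun (Adjointable B F G) fun _ => F → G := ⟨fun T => T.toCLM⟩

theorem inner_adj' (T : Adjointable B F G) (x : F) (y : G) :
    inner Bᵐᵒᵖ x (T.adj y) = inner Bᵐᵒᵖ (T.toCLM x) y := by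
  rw [← CStarModule.star_inner, T.inner_adj, CStarModule.star_inner]

theorem toCLM_injective :
    Function.Injective (toCLM : Adjointable B F G → F →L[ℂ] G) := by
  rintro ⟨f, f', hf⟩ ⟨g, g', hg⟩ h
  obtain rfl : f = g := h
  have : f' = g' := by
    ext y
    refine HilbertModule.ext_inner (R := Bᵐᵒᵖ) fun w => ?_
    rw [← CStarModule.star_inner, hf, ← hg, CStarModule.star_inner]
  subst this
  rfl

@[ext] theorem ext {S T : Adjointable B F G} (h : ∀ x, S x = T x) : S = T :=
  toCLM_injective (ContinuousLinearMap.ext h)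

/-- The adjoint `T⋆ : G → F` of an adjointable operator `T : F → G`. -/
def adjoint (T : Adjointable B F G) : Adjointable B G F where
  toCLM := T.adj
  adj := T.toCLM
  inner_adj x y := (T.inner_adj' y x).symm

/-- The composite `S ∘ T`. -/
def comp (S : Adjointable B G H) (T : Adjointable B F G) : Adjointable B F H where
  toCLM := S.toCLM.comp T.toCLM
  adj := T.adj.comp S.adj
  inner_adj x y := by simp [inner_adj]

instance : Zero (Adjointable B F G) := ⟨⟨0, 0, fun x y => by simp⟩⟩
instance : Add (Adjointable B F G) :=
  ⟨fun S T => ⟨S.toCLM + T.toCLM, S.adj + T.adj, fun x y => by simp [inner_adj]⟩⟩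
instance : Neg (Adjointable B F G) :=
  ⟨fun S => ⟨-S.toCLM, -S.adj, fun x y => by simp [inner_adj]⟩⟩
instance : Sub (Adjointable B F G) :=
  ⟨fun S T => ⟨S.toCLM - T.toCLM, S.adj - T.adj, fun x y => by simp [inner_adj]⟩⟩
instance : SMul ℂ (Adjointable B F G) :=
  ⟨fun z S => ⟨z • S.toCLM, star z • S.adj, fun x y => by simp [inner_adj]⟩⟩
instance : SMul ℕ (Adjointable B F G) :=
  ⟨fun n S => ⟨n • S.toCLM, n • S.adj, fun x y => by
    simp [← Nat.cast_smul_eq_nsmul ℂ, inner_adj]⟩⟩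
instance : SMul ℤ (Adjointable B F G) :=
  ⟨fun n S => ⟨n • S.toCLM, n • S.adj, fun x y => by
    simp [← Int.cast_smul_eq_zsmul ℂ, inner_adj]⟩⟩

instance : AddCommGroup (Adjointable B F G) :=
  toCLM_injective.addCommGroup _ rfl (fun _ _ => rfl) (fun _ => rfl) (fun _ _ => rfl)
    (fun _ _ => rfl) (fun _ _ => rfl)

/-- The inclusion of adjointable operators into bounded operators. -/
def toCLMAddHom : Adjointable B F G →+ (F →L[ℂ] G) where
  toFun := toCLM
  map_zero' := rfl
  map_add' _ _ := rfl

instance : Module ℂ (Adjointable B F G) :=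
  toCLM_injective.module ℂ toCLMAddHom fun _ _ => rfl

instance : NormedAddCommGroup (Adjointable B F G) :=
  NormedAddCommGroup.induced _ _ toCLMAddHom toCLM_injective

theorem norm_def (T : Adjointable B F G) : ‖T‖ = ‖T.toCLM‖ := rfl

instance : NormedSpace ℂ (Adjointable B F G) where
  norm_smul_le z T := norm_smul_le z T.toCLM

instance : Mul (Adjointable B F F) := ⟨comp⟩
instance : One (Adjointable B F F) := ⟨⟨1, 1, fun _ _ => rfl⟩⟩
instance : Star (Adjointable B F F) := ⟨adjoint⟩

@[simp] theorem zero_apply (x : F) : (0 : Adjointable B F G) x = 0 := rfl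
@[simp] theorem add_apply (S T : Adjointable B F G) (x : F) : (S + T) x = S x + T x := rfl
@[simp] theorem smul_apply (z : ℂ) (T : Adjointable B F G) (x : F) : (z • T) x = z • T x := rfl
@[simp] theorem mul_apply (S T : Adjointable B F F) (x : F) : (S * T) x = S (T x) := rfl
@[simp] theorem one_apply (x : F) : (1 : Adjointable B F F) x = x := rfl
@[simp] theorem comp_apply (S : Adjointable B G H) (T : Adjointable B F G) (x : F) :
    (S.comp T) x = S (T x) := rfl

instance : Ring (Adjointable B F F) where
  left_distrib S T U := by ext x; simp
  right_distrib S T U := by ext x; simp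
  zero_mul S := by ext x; simp
  mul_zero S := by ext x; simp
  mul_assoc S T U := by ext x; simp
  one_mul S := by ext x; simp
  mul_one S := by ext x; simp
  zsmul := fun n S => n • S
  zsmul_zero' := fun S => zero_zsmul S
  zsmul_succ' := fun n S => SubNegMonoid.zsmul_succ' n S
  zsmul_neg' := fun n S => SubNegMonoid.zsmul_neg' n S
  neg_add_cancel := neg_add_cancel
  sub_eq_add_neg := sub_eq_add_neg

instance : NormedRing (Adjointable B F F) where
  dist_eq S T := NormedAddGroup.dist_eq S T
  norm_mul_le S T := ContinuousLinearMap.opNorm_comp_le S.toCLM T.toCLM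

instance : Algebra ℂ (Adjointable B F F) :=
  Algebra.ofModule (fun z S T => by ext x; simp) (fun z S T => by ext x; simp)

instance : NormedAlgebra ℂ (Adjointable B F F) where
  norm_smul_le := norm_smul_le

theorem norm_adj_le (T : Adjointable B F G) : ‖T.adj‖ ≤ ‖T.toCLM‖ := by
  refine T.adj.opNorm_le_bound (norm_nonneg _) fun y => ?_
  rcases (norm_nonneg (T.adj y)).eq_or_lt with h | h
  · rw [← h]; positivity
  · refine le_of_mul_le_mul_right ?_ h
    calc ‖T.adj y‖ * ‖T.adj y‖ = ‖inner Bᵐᵒᵖ (T.adj y) (T.adj y)‖ := by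
          rw [← sq, CStarModule.norm_sq_eq Bᵐᵒᵖ]
      _ = ‖inner Bᵐᵒᵖ y (T.toCLM (T.adj y))‖ := by rw [T.inner_adj]
      _ ≤ ‖y‖ * (‖T.toCLM‖ * ‖T.adj y‖) :=
          (CStarModule.norm_inner_le _).trans (by gcongr; exact T.toCLM.le_opNorm _)
      _ = _ := by ring

theorem norm_adj (T : Adjointable B F G) : ‖T.adj‖ = ‖T.toCLM‖ :=
  le_antisymm T.norm_adj_le T.adjoint.norm_adj_le

instance : StarRing (Adjointable B F F) where
  star_involutive _ := rfl
  star_mul _ _ := rfl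
  star_add _ _ := rfl

instance : StarModule ℂ (Adjointable B F F) := ⟨fun _ _ => toCLM_injective rfl⟩

theorem star_eq (T : Adjointable B F F) : star T = T.adjoint := rfl

instance : CStarRing (Adjointable B F F) where
  norm_mul_self_le T := by
    rw [norm_def T, ← sq]
    have : ‖T.toCLM‖ ≤ √‖star T * T‖ := by
      refine T.toCLM.opNorm_le_bound (Real.sqrt_nonneg _) fun x => ?_
      refine le_of_sq_le_sq ?_ (by positivity)
      rw [mul_pow, Real.sq_sqrt (norm_nonneg _), CStarModule.norm_sq_eq Bᵐᵒᵖ]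
      calc ‖inner Bᵐᵒᵖ (T.toCLM x) (T.toCLM x)‖ = ‖inner Bᵐᵒᵖ x ((star T * T).toCLM x)‖ := by
            rw [← T.inner_adj']; rfl
        _ ≤ ‖x‖ * (‖(star T * T).toCLM‖ * ‖x‖) :=
          (CStarModule.norm_inner_le _).trans (by gcongr; exact ContinuousLinearMap.le_opNorm _ _)
        _ = _ := by rw [norm_def]; ring
    calc _ ≤ (√‖star T * T‖) ^ 2 := by gcongr
      _ = _ := Real.sq_sqrt (norm_nonneg _)

theorem isClosed_range_pair :
    IsClosed {p : (F →L[ℂ] G) × (G →L[ℂ] F) |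
      ∀ x y, inner Bᵐᵒᵖ (p.2 y) x = inner Bᵐᵒᵖ y (p.1 x)} := by
  simp only [Set.ofPred_forall]
  refine isClosed_iInter fun x => isClosed_iInter fun y => ?_
  refine isClosed_eq ?_ ?_
  · exact CStarModule.continuous_inner.comp
      (f := fun p : (F →L[ℂ] G) × (G →L[ℂ] F) => (p.2 y, x)) (by fun_prop)
  · exact CStarModule.continuous_inner.comp
      (f := fun p : (F →L[ℂ] G) × (G →L[ℂ] F) => (y, p.1 x)) (by fun_prop)

instance [CompleteSpace F] [CompleteSpace G] : CompleteSpace (Adjointable B F G) := by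
  refine Metric.complete_of_cauchySeq_tendsto fun u hu => ?_
  have hn : ∀ S T : Adjointable B F G, dist S.adj T.adj = dist S T := fun S T => by
    rw [dist_eq_norm, dist_eq_norm]; exact (S - T).norm_adj
  have h1 : CauchySeq fun n => (u n).toCLM := by
    rw [Metric.cauchySeq_iff] at hu ⊢
    exact hu
  have h2 : CauchySeq fun n => (u n).adj := by
    rw [Metric.cauchySeq_iff] at hu ⊢
    simpa only [hn] using hu
  obtain ⟨f, hf⟩ := cauchySeq_tendsto_of_complete h1
  obtain ⟨g, hg⟩ := cauchySeq_tendsto_of_complete h2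
  have := (isClosed_range_pair (B := B) (F := F) (G := G)).mem_of_tendsto (hf.prodMk_nhds hg)
    (Filter.Eventually.of_forall fun n => (u n).inner_adj)
  refine ⟨⟨f, g, this⟩, ?_⟩
  rw [tendsto_iff_dist_tendsto_zero] at hf ⊢
  exact hf

instance [CompleteSpace F] : CStarAlgebra (Adjointable B F F) where

end Adjointable

section Compact
variable {B E F : Type*} [NonUnitalCStarAlgebra B] [PartialOrder B] [StarOrderedRing B]
  [NormedAddCommGroup E] [NormedSpace ℂ E] [SMul Bᵐᵒᵖ E] [CStarModule Bᵐᵒᵖ E]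
  [NormedAddCommGroup F] [NormedSpace ℂ F] [SMul Bᵐᵒᵖ F] [CStarModule Bᵐᵒᵖ F]

/-- The map `r ↦ r • ξ`. -/
def actCLM (ξ : F) : Bᵐᵒᵖ →L[ℂ] F :=
  LinearMap.mkContinuous
    { toFun := fun r => r • ξ
      map_add' := fun r s => HilbertModule.add_smul' r s ξ
      map_smul' := fun z r => HilbertModule.smul_assoc' z r ξ } ‖ξ‖
    fun r => (HilbertModule.norm_smul_le' r ξ).trans_eq (mul_comm _ _)

/-- The rank-one operator `|ξ⟩⟨η| : ζ ↦ ξ · ⟪η, ζ⟫`. -/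
def rankOne (ξ : F) (η : E) : Adjointable B E F where
  toCLM := (actCLM ξ).comp (CStarModule.innerSL (A := Bᵐᵒᵖ) η)
  adj := (actCLM η).comp (CStarModule.innerSL (A := Bᵐᵒᵖ) ξ)
  inner_adj x y := by
    simp [actCLM, CStarModule.innerSL_apply]

theorem rankOne_apply (ξ : F) (η ζ : E) :
    rankOne (B := B) ξ η ζ = inner Bᵐᵒᵖ η ζ • ξ := rfl

theorem mul_rankOne (T : Adjointable B F F) (ξ : F) (η : F) :
    T * rankOne ξ η = rankOne (T ξ) η := by
  ext ζ
  refine HilbertModule.ext_inner (R := Bᵐᵒᵖ) fun w => ?_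
  simp [rankOne_apply, ← T.inner_adj]

theorem star_rankOne (ξ η : F) : star (rankOne (B := B) ξ η) = rankOne η ξ := rfl

variable (B E) in
/-- The linear span of the rank-one operators. -/
def finiteRankOperators : NonUnitalStarSubalgebra ℂ (Adjointable B E E) where
  __ := Submodule.span ℂ (Set.range fun p : E × E => rankOne (B := B) p.1 p.2)
  mul_mem' {S T} _ hT := by
    simp only [AddSubsemigroup.mem_carrier, AddSubmonoid.mem_toSubsemigroup,
      Submodule.mem_toAddSubmonoid] at hT ⊢
    change S * T ∈ Submodule.span ℂ _
    induction hT using Submodule.span_induction with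
    | mem T h =>
      obtain ⟨⟨ξ, η⟩, rfl⟩ := h
      simp only [mul_rankOne]
      exact Submodule.subset_span ⟨(S ξ, η), rfl⟩
    | zero => simp
    | add T U _ _ h1 h2 => rw [mul_add]; exact add_mem h1 h2
    | smul z T _ h => rw [mul_smul_comm]; exact Submodule.smul_mem _ _ h
  star_mem' {T} hT := by
    change T ∈ Submodule.span ℂ _ at hT
    change star T ∈ Submodule.span ℂ _
    induction hT using Submodule.span_induction with
    | mem T h =>
      obtain ⟨⟨ξ, η⟩, rfl⟩ := h
      exact Submodule.subset_span ⟨(η, ξ), rfl⟩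
    | zero => simp
    | add T U _ _ h1 h2 => rw [star_add]; exact add_mem h1 h2
    | smul z T _ h => rw [star_smul]; exact Submodule.smul_mem _ _ h

variable (B E) in
/-- `𝕂(E)`: the norm-closed linear span of the rank-one operators in `𝔹(E)`. -/
def compactOperators [CompleteSpace E] : NonUnitalStarSubalgebra ℂ (Adjointable B E E) :=
  (finiteRankOperators B E).topologicalClosure

theorem rankOne_mem [CompleteSpace E] (ξ η : E) : rankOne ξ η ∈ compactOperators B E :=
  subset_closure (Submodule.subset_span ⟨(ξ, η), rfl⟩)
end Compact

/-- A module with a semi-inner product with values in a C⋆-algebra: the axioms of `CStarModule`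
without definiteness and without a norm. -/
class PreCStarModule (R X : Type*) [NonUnitalCStarAlgebra R] [PartialOrder R]
    [AddCommGroup X] [Module ℂ X] [SMul R X] extends Inner R X where
  inner_add_right {x y z : X} : inner x (y + z) = inner x y + inner x z
  inner_self_nonneg {x : X} : 0 ≤ inner x x
  inner_op_smul_right {r : R} {x y : X} : inner x (r • y) = r * inner x y
  inner_smul_right_complex {z : ℂ} {x y : X} : inner x (z • y) = z • inner x y
  star_inner (x y : X) : star (inner x y) = inner y x

namespace PreCStarModule
section
variable {R X : Type*} [NonUnitalCStarAlgebra R] [PartialOrder R] [StarOrderedRing R]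
    [AddCommGroup X] [Module ℂ X] [SMul R X] [PreCStarModule R X]

theorem add_left (x y z : X) : inner R (x + y) z = inner R x z + inner R y z := by
  rw [← star_inner, inner_add_right, star_add, star_inner, star_inner]

theorem op_smul_left (r : R) (x y : X) : inner R (r • x) y = inner R x y * star r := by
  rw [← star_inner, inner_op_smul_right, star_mul, star_inner]

theorem smul_left (z : ℂ) (x y : X) : inner R (z • x) y = star z • inner R x y := by
  rw [← star_inner, inner_smul_right_complex, star_smul, star_inner]

/-- The semi-inner product as a sesquilinear map. -/
def innerₛₗ : X →ₗ⋆[ℂ] X →ₗ[ℂ] R where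
  toFun x :=
    { toFun := fun y => inner R x y
      map_add' := fun _ _ => inner_add_right
      map_smul' := fun _ _ => inner_smul_right_complex }
  map_add' x y := by ext z; exact add_left x y z
  map_smul' z x := by ext y; exact smul_left z x y

theorem innerₛₗ_apply (x y : X) : innerₛₗ (R := R) x y = inner R x y := rfl

theorem norm_inner_sq_le (x y : X) :
    ‖inner R x y‖ ^ 2 ≤ ‖inner R x x‖ * ‖inner R y y‖ := by
  have key : ∀ N : ℝ, ‖inner R x x‖ < N → ‖inner R x y‖ ^ 2 ≤ N * ‖inner R y y‖ := by
    intro N hN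
    have hN0 : 0 < N := (norm_nonneg _).trans_lt hN
    set a : R := inner R x y with ha
    have ha' : inner R y x = star a := (star_inner x y).symm
    have h0 : 0 ≤ inner R (a • x + (-(N : ℂ)) • y) (a • x + (-(N : ℂ)) • y) :=
      inner_self_nonneg
    have h1 : inner R (a • x + (-(N : ℂ)) • y) (a • x + (-(N : ℂ)) • y)
        = a * inner R x x * star a - (2 * N) • (a * star a) + (N ^ 2) • inner R y y := by
      simp only [inner_add_right, add_left, inner_op_smul_right, op_smul_left,
        inner_smul_right_complex, smul_left, ha', ← ha]
      have e : ∀ (r : ℝ) (z : R), (r : ℂ) • z = r • z := fun r z => by simp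
      have e2 : star (-(N : ℂ)) = ((-N : ℝ) : ℂ) := by simp
      have e3 : (-(N : ℂ)) = ((-N : ℝ) : ℂ) := by simp
      rw [e2, e3]
      simp only [e, mul_smul_comm, mul_assoc, mul_add]
      module
    have h2 : a * inner R x x * star a ≤ ‖inner R x x‖ • (a * star a) :=
      CStarAlgebra.star_right_conjugate_le_norm_smul (a := a) (b := inner R x x)
        (hb := inner_self_nonneg (R := R) (x := x) |>.isSelfAdjoint)
    have h3 : ‖inner R x x‖ • (a * star a) ≤ N • (a * star a) := by
      gcongr
      exact mul_star_self_nonneg a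
    have h4 : a * star a ≤ N • inner R y y := by
      have : 0 ≤ N • (a * star a) - (2 * N) • (a * star a) + (N ^ 2) • inner R y y := by
        refine (h1 ▸ h0).trans ?_
        gcongr
        exact h2.trans h3
      have h5 : N • (a * star a) ≤ N • (N • inner R y y) := by
        rw [← sub_nonneg]
        refine this.trans_eq ?_
        module
      exact (smul_le_smul_iff_of_pos_left hN0).mp h5
    calc ‖a‖ ^ 2 = ‖a * star a‖ := by rw [CStarRing.norm_self_mul_star, sq]
      _ ≤ ‖N • inner R y y‖ :=
        CStarAlgebra.norm_le_norm_of_nonneg_of_le (mul_star_self_nonneg a) h4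
      _ = N * ‖inner R y y‖ := by rw [norm_smul, Real.norm_of_nonneg hN0.le]
  refine le_of_forall_pos_le_add fun ε hε => ?_
  have hd : 0 < ‖inner R y y‖ + 1 := by positivity
  refine (key (‖inner R x x‖ + ε / (‖inner R y y‖ + 1)) (by linarith [div_pos hε hd])).trans ?_
  rw [add_mul]
  gcongr
  rw [div_mul_eq_mul_div, div_le_iff₀ hd]
  nlinarith

variable (R X) in
/-- The seminorm `‖x‖ = ‖⟪x, x⟫‖^(1/2)`. -/
@[reducible] def toNorm : Norm X := ⟨fun x => √‖inner R x x‖⟩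

variable (R X) in
theorem core : @SeminormedSpace.Core ℂ X _ _ (toNorm R X) _ := by
  let _ := toNorm R X
  have hn : ∀ x : X, ‖x‖ = √‖inner R x x‖ := fun _ => rfl
  refine ⟨fun _ => Real.sqrt_nonneg _, fun z x => ?_, fun x y => ?_⟩
  · rw [hn, hn, smul_left, inner_smul_right_complex, smul_smul, norm_smul]
    simp
  · have hcs : ∀ a b : X, ‖inner R a b‖ ≤ ‖a‖ * ‖b‖ := fun a b => by
      rw [hn, hn, ← Real.sqrt_mul (norm_nonneg _)]
      exact Real.le_sqrt_of_sq_le (norm_inner_sq_le a b)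
    have hsq : ∀ a : X, ‖inner R a a‖ = ‖a‖ * ‖a‖ := fun a => by
      rw [hn, Real.mul_self_sqrt (norm_nonneg _)]
    rw [hn (x + y), Real.sqrt_le_iff]
    refine ⟨add_nonneg (Real.sqrt_nonneg _) (Real.sqrt_nonneg _), ?_⟩
    rw [inner_add_right, add_left, add_left]
    calc _ ≤ (‖inner R x x‖ + ‖inner R y x‖) + (‖inner R x y‖ + ‖inner R y y‖) :=
          (norm_add_le _ _).trans (add_le_add (norm_add_le _ _) (norm_add_le _ _))
      _ ≤ (‖x‖ * ‖x‖ + ‖y‖ * ‖x‖) + (‖x‖ * ‖y‖ + ‖y‖ * ‖y‖) := by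
          rw [hsq, hsq]
          gcongr <;> exact hcs _ _
      _ = _ := by ring

variable (R X) in
/-- The seminormed group defined by a semi-inner product. -/
@[reducible] def seminormedAddCommGroup : SeminormedAddCommGroup X :=
  letI := toNorm R X
  SeminormedAddCommGroup.ofCore (core R X)

variable (R X) in
/-- The seminormed space defined by a semi-inner product. -/
@[reducible] def normedSpace :
    letI := seminormedAddCommGroup R X
    NormedSpace ℂ X :=
  letI := seminormedAddCommGroup R X
  { ‹Module ℂ X› with
    norm_smul_le := fun z x => ((core R X).norm_smul z x).le }
end

section completion
variable {R X : Type*} [NonUnitalCStarAlgebra R] [PartialOrder R] [StarOrderedRing R]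
    [SeminormedAddCommGroup X] [NormedSpace ℂ X] [SMul R X] [PreCStarModule R X]

/-- The seminorm of `X` comes from its semi-inner product. -/
class NormCompat (R X : Type*) [NonUnitalCStarAlgebra R] [PartialOrder R]
    [SeminormedAddCommGroup X] [NormedSpace ℂ X] [SMul R X] [PreCStarModule R X] : Prop where
  norm_eq : ∀ x : X, ‖x‖ = √‖inner R x x‖

variable [NormCompat R X]

theorem norm_sq (x : X) : ‖x‖ ^ 2 = ‖inner R x x‖ := by
  rw [NormCompat.norm_eq (R := R) x, Real.sq_sqrt (norm_nonneg _)]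

theorem norm_inner_le (x y : X) : ‖inner R x y‖ ≤ ‖x‖ * ‖y‖ := by
  refine le_of_sq_le_sq ?_ (by positivity)
  rw [mul_pow, norm_sq (R := R) x, norm_sq (R := R) y]
  exact norm_inner_sq_le x y

theorem norm_op_smul_le (r : R) (x : X) : ‖r • x‖ ≤ ‖r‖ * ‖x‖ := by
  refine le_of_sq_le_sq ?_ (by positivity)
  rw [mul_pow, norm_sq (R := R) (r • x), norm_sq (R := R) x, inner_op_smul_right, op_smul_left]
  calc _ ≤ ‖r‖ * (‖inner R x x‖ * ‖star r‖) :=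
          (norm_mul_le _ _).trans (by gcongr; exact norm_mul_le _ _)
      _ = _ := by rw [norm_star]; ring

/-- The semi-inner product as a continuous sesquilinear map. -/
def innerSL : X →L⋆[ℂ] X →L[ℂ] R :=
  LinearMap.mkContinuous₂ (innerₛₗ (R := R)) 1 fun x y => by
    rw [one_mul]; exact norm_inner_le x y

theorem continuous_inner : Continuous fun p : X × X => inner R p.1 p.2 := by
  change Continuous fun p : X × X => innerSL (R := R) p.1 p.2
  fun_prop

theorem completion_inner_coe (x y : X) :
    inner R (x : Completion X) (y : Completion X) = inner R x y :=
  (Completion.isDenseInducing_coe.prodMap Completion.isDenseInducing_coe).extend_eq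
    (continuous_inner : Continuous (Function.uncurry (inner R (E := X)))) (x, y)

theorem completion_continuous_inner :
    Continuous fun p : Completion X × Completion X => inner R p.1 p.2 := by
  let inner' : X →+ X →+ R :=
    { toFun := fun x => (innerₛₗ (R := R) x).toAddMonoidHom
      map_zero' := by ext x; simp
      map_add' := fun x y => by ext z; exact add_left _ _ _ }
  have : Continuous fun p : X × X => inner' p.1 p.2 := continuous_inner
  exact (UniformSpace.Completion.isDenseInducing_toCompl X).extend_Z_bilin (UniformSpace.Completion.isDenseInducing_toCompl X) this

theorem Continuous.completion_inner {α : Type*} [TopologicalSpace α] {f g : α → Completion X}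
    (hf : Continuous f) (hg : Continuous g) : Continuous fun a => inner R (f a) (g a) :=
  completion_continuous_inner.comp (hf.prodMk hg)

/-- The completion of a semi-inner product module is a Hilbert module. -/
@[reducible] def completionCStarModule (hu : UniformContinuousConstSMul R X) :
    CStarModule R (Completion X) where
  inner_add_right {x y z} := by
    refine Completion.induction_on₃ x y z (isClosed_eq ?_ ?_) fun a b c => ?_
    · exact Continuous.completion_inner continuous_fst
        (continuous_snd.fst.add continuous_snd.snd)
    · exact (Continuous.completion_inner continuous_fst continuous_snd.fst).add
        (Continuous.completion_inner continuous_fst continuous_snd.snd)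
    · rw [← Completion.coe_add]
      simp only [completion_inner_coe, inner_add_right]
  inner_self_nonneg {x} := by
    refine Completion.induction_on x (isClosed_le continuous_const ?_) fun a => ?_
    · exact Continuous.completion_inner continuous_id continuous_id
    · rw [completion_inner_coe]; exact inner_self_nonneg
  inner_self {x} := by
    have h : ‖x‖ = √‖inner R x x‖ := by
      refine Completion.induction_on x (isClosed_eq continuous_norm ?_) fun a => ?_
      · exact (Continuous.completion_inner continuous_id continuous_id).norm.sqrt
      · rw [completion_inner_coe, Completion.norm_coe, NormCompat.norm_eq (R := R)]
    rw [← norm_eq_zero, ← norm_eq_zero (a := x), h, Real.sqrt_eq_zero (norm_nonneg _)]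
  inner_op_smul_right {r x y} := by
    refine Completion.induction_on₂ x y (isClosed_eq ?_ ?_) fun a b => ?_
    · exact Continuous.completion_inner continuous_fst (continuous_snd.const_smul r)
    · exact continuous_const.mul (Continuous.completion_inner continuous_fst continuous_snd)
    · rw [← Completion.coe_smul, completion_inner_coe, completion_inner_coe,
        inner_op_smul_right]
  inner_smul_right_complex {z x y} := by
    refine Completion.induction_on₂ x y (isClosed_eq ?_ ?_) fun a b => ?_
    · exact Continuous.completion_inner continuous_fst (continuous_snd.const_smul z)
    · exact (Continuous.completion_inner continuous_fst continuous_snd).const_smul z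
    · rw [← Completion.coe_smul, completion_inner_coe, completion_inner_coe,
        inner_smul_right_complex]
  star_inner x y := by
    refine Completion.induction_on₂ x y (isClosed_eq ?_ ?_) fun a b => ?_
    · exact (Continuous.completion_inner continuous_fst continuous_snd).star
    · exact Continuous.completion_inner continuous_snd continuous_fst
    · rw [completion_inner_coe, completion_inner_coe, star_inner]
  norm_eq_sqrt_norm_inner_self x := by
    refine Completion.induction_on x (isClosed_eq continuous_norm ?_) fun a => ?_
    · exact (Continuous.completion_inner continuous_id continuous_id).norm.sqrt
    · rw [completion_inner_coe, Completion.norm_coe, NormCompat.norm_eq (R := R)]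

end completion
end PreCStarModule

section Right
variable {B E : Type*} [NonUnitalCStarAlgebra B] [PartialOrder B] [StarOrderedRing B]
  [NormedAddCommGroup E] [NormedSpace ℂ E] [SMul Bᵐᵒᵖ E] [CStarModule Bᵐᵒᵖ E]

variable (B) in
/-- The `B`-valued inner product of a right Hilbert `B`-module, linear in the second variable. -/
def rinner (x y : E) : B := (inner Bᵐᵒᵖ x y).unop

theorem op_rinner (x y : E) : MulOpposite.op (rinner B x y) = inner Bᵐᵒᵖ x y := rfl

theorem star_rinner (x y : E) : star (rinner B x y) = rinner B y x :=
  MulOpposite.op_injective (by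
    rw [MulOpposite.op_star, op_rinner, op_rinner, CStarModule.star_inner])

theorem rinner_self_nonneg (x : E) : 0 ≤ rinner B x x :=
  CStarModule.inner_self_nonneg (A := Bᵐᵒᵖ) (x := x)

theorem rinner_add_right (x y z : E) : rinner B x (y + z) = rinner B x y + rinner B x z := by
  simp [rinner]

theorem rinner_add_left (x y z : E) : rinner B (x + y) z = rinner B x z + rinner B y z := by
  simp [rinner]

theorem rinner_smul_right (x : E) (z : ℂ) (y : E) :
    rinner B x (z • y) = z • rinner B x y := by
  simp [rinner]

theorem rinner_smul_left (x : E) (z : ℂ) (y : E) :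
    rinner B (z • x) y = star z • rinner B x y := by
  simp [rinner]

theorem rinner_op_smul_right (x y : E) (b : B) :
    rinner B x (MulOpposite.op b • y) = rinner B x y * b := by
  simp [rinner]

theorem rinner_op_smul_left (x y : E) (b : B) :
    rinner B (MulOpposite.op b • x) y = star b * rinner B x y := by
  simp [rinner]

theorem rinner_sum_right {ι : Type*} (s : Finset ι) (x : E) (y : ι → E) :
    rinner B x (∑ i ∈ s, y i) = ∑ i ∈ s, rinner B x (y i) :=
  map_sum (AddMonoidHom.mk' (fun y => rinner B x y) (rinner_add_right x)) _ _

theorem rinner_sum_left {ι : Type*} (s : Finset ι) (x : ι → E) (y : E) :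
    rinner B (∑ i ∈ s, x i) y = ∑ i ∈ s, rinner B (x i) y :=
  map_sum (AddMonoidHom.mk' (fun x => rinner B x y) (fun a b => rinner_add_left a b y)) _ _

theorem exists_conjugate_eq_neg {D : Type*} [NonUnitalCStarAlgebra D] [PartialOrder D]
    [StarOrderedRing D] (M : D) (hM : IsSelfAdjoint M) :
    ∃ P S : D, star P * M * P = -(star (S * P) * (S * P)) ∧
      (S * P = 0 → ∃ N, M = star N * N) := by
  have hPn : 0 ≤ M⁻ := CFC.negPart_nonneg M
  have hPs : star M⁻ = M⁻ := hPn.isSelfAdjoint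
  obtain ⟨S, hS⟩ := CStarAlgebra.nonneg_iff_eq_star_mul_self.mp hPn
  refine ⟨M⁻, S, ?_, fun h4 => ?_⟩
  · have h2 : M * M⁻ = -(M⁻ * M⁻) := by
      conv_lhs => enter [1]; rw [← CFC.posPart_sub_negPart M]
      rw [sub_mul, CFC.posPart_mul_negPart, zero_sub]
    have h3 : M⁻ * M⁻ = star S * (S * M⁻) := by
      rw [← mul_assoc, ← hS]
    rw [mul_assoc, h2, star_mul, hPs, h3, mul_neg, ← mul_assoc, mul_assoc]
  · rw [← CStarAlgebra.nonneg_iff_eq_star_mul_self, ← CFC.negPart_eq_zero_iff M]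
    have h9 : star M⁻ * M⁻ = 0 := by
      rw [hPs]
      have h3 : M⁻ * M⁻ = star S * (S * M⁻) := by
        rw [← mul_assoc, ← hS]
      rw [h3, h4, mul_zero]
    exact (CStarRing.star_mul_self_eq_zero_iff _).mp h9

theorem exists_gram_factor {ι : Type*} [Fintype ι] (ξ : ι → E) :
    ∃ N : ι → ι → B, ∀ i j, rinner B (ξ i) (ξ j) = ∑ k, star (N k i) * N k j := by
  let M : CStarMatrix ι ι B := CStarMatrix.ofMatrix (Matrix.of fun i j => rinner B (ξ i) (ξ j))
  have hM : ∀ i j, M i j = rinner B (ξ i) (ξ j) := fun i j => rfl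
  have hsa : IsSelfAdjoint M := by
    ext i j
    rw [CStarMatrix.star_apply, hM, hM, star_rinner]
  obtain ⟨P, S, h1, h2⟩ := exists_conjugate_eq_neg M hsa
  have h3 : ∀ i, (star P * M * P) i i
      = rinner B (∑ k, MulOpposite.op (P k i) • ξ k) (∑ k, MulOpposite.op (P k i) • ξ k) := by
    intro i
    simp only [CStarMatrix.mul_apply, CStarMatrix.star_apply, hM, rinner_sum_left,
      rinner_sum_right, rinner_op_smul_left, rinner_op_smul_right, Finset.sum_mul,
      mul_assoc]
  have h4 : S * P = 0 := by
    ext k i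
    have h5 : 0 ≤ - ∑ k, star ((S * P) k i) * (S * P) k i := by
      have h6 : (star P * M * P) i i = - ∑ k, star ((S * P) k i) * (S * P) k i := by
        rw [h1, CStarMatrix.neg_apply, CStarMatrix.mul_apply]
        simp only [CStarMatrix.star_apply]
      rw [← h6, h3]
      exact rinner_self_nonneg _
    have h7 : ∑ k, star ((S * P) k i) * (S * P) k i = 0 :=
      le_antisymm (neg_nonneg.mp h5) (Finset.sum_nonneg fun k _ => star_mul_self_nonneg _)
    have h8 := (Finset.sum_eq_zero_iff_of_nonneg
      (fun k _ => star_mul_self_nonneg ((S * P) k i))).mp h7 k (Finset.mem_univ k)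
    exact (CStarRing.star_mul_self_eq_zero_iff _).mp h8
  obtain ⟨N, hN⟩ := h2 h4
  refine ⟨N, fun i j => ?_⟩
  rw [← hM, hN, CStarMatrix.mul_apply]
  simp only [CStarMatrix.star_apply]
end Right

open scoped TensorProduct

section Tensor
variable {B C E F : Type*}
  [NonUnitalCStarAlgebra B] [PartialOrder B] [StarOrderedRing B]
  [NonUnitalCStarAlgebra C] [PartialOrder C] [StarOrderedRing C]
  [NormedAddCommGroup E] [NormedSpace ℂ E] [SMul Bᵐᵒᵖ E] [CStarModule Bᵐᵒᵖ E]
  [NormedAddCommGroup F] [NormedSpace ℂ F] [SMul Cᵐᵒᵖ F] [CStarModule Cᵐᵒᵖ F]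

/-! ### The interior tensor product -/

variable (E) in
/-- The algebraic tensor product `E ⊗ F` of a Hilbert `B`-module `E` and a Hilbert `C`-module `F`
with a left action `φ` of `B`; it carries the semi-inner product
`⟪ξ ⊗ η, ξ' ⊗ η'⟫ = ⟪η, φ(⟪ξ, ξ'⟫) η'⟫`. -/
def PreTensor (_φ : B →⋆ₙₐ[ℂ] Adjointable C F F) : Type _ := E ⊗[ℂ] F

namespace PreTensor
variable (φ : B →⋆ₙₐ[ℂ] Adjointable C F F)

instance : AddCommGroup (PreTensor E φ) := inferInstanceAs (AddCommGroup (E ⊗[ℂ] F))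
instance instModuleAlg : Module ℂ (PreTensor E φ) := inferInstanceAs (Module ℂ (E ⊗[ℂ] F))

variable {φ} in
theorem induction {p : PreTensor E φ → Prop} (x : PreTensor E φ) (zero : p 0)
    (tmul : ∀ (ξ : E) (η : F), p (ξ ⊗ₜ[ℂ] η : E ⊗[ℂ] F))
    (add : ∀ x y, p x → p y → p (x + y)) : p x :=
  TensorProduct.induction_on x zero tmul add

/-- The elementary tensor `ξ ⊗ η`. -/
def mk (ξ : E) (η : F) : PreTensor E φ := (ξ ⊗ₜ[ℂ] η : E ⊗[ℂ] F)

/-- Right multiplication by an element of `C` on `F`. -/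
def opSMulLM (r : Cᵐᵒᵖ) : F →ₗ[ℂ] F where
  toFun η := r • η
  map_add' := HilbertModule.smul_add' r
  map_smul' z η := HilbertModule.smul_comm' r z η

instance : SMul Cᵐᵒᵖ (PreTensor E φ) :=
  ⟨fun r x => TensorProduct.map (LinearMap.id : E →ₗ[ℂ] E) (opSMulLM r) x⟩

/-- `ξ' ⊗ η' ↦ ⟪η, φ(⟪ξ, ξ'⟫) η'⟫`. -/
def formRight (ξ : E) (η : F) : E ⊗[ℂ] F →ₗ[ℂ] Cᵐᵒᵖ :=
  TensorProduct.lift (LinearMap.mk₂ ℂ (fun ξ' η' => inner Cᵐᵒᵖ η (φ (rinner B ξ ξ') η'))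
    (fun ξ₁ ξ₂ η' => by simp [rinner_add_right])
    (fun z ξ₁ η' => by simp [rinner_smul_right])
    (fun ξ₁ η₁ η₂ => by simp)
    (fun z ξ₁ η₁ => by simp))

theorem formRight_tmul (ξ ξ' : E) (η η' : F) :
    formRight φ ξ η (ξ' ⊗ₜ η') = inner Cᵐᵒᵖ η (φ (rinner B ξ ξ') η') := rfl

variable (E) in
/-- The semi-inner product `⟪ξ ⊗ η, ξ' ⊗ η'⟫ = ⟪η, φ(⟪ξ, ξ'⟫) η'⟫`. -/
def form : E ⊗[ℂ] F →ₗ⋆[ℂ] E ⊗[ℂ] F →ₗ[ℂ] Cᵐᵒᵖ :=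
  TensorProduct.lift (LinearMap.mk₂'ₛₗ (starRingEnd ℂ) (starRingEnd ℂ) (formRight φ)
    (fun ξ₁ ξ₂ η => by ext; simp [formRight_tmul, rinner_add_left])
    (fun z ξ η => by ext; simp [formRight_tmul, rinner_smul_left])
    (fun ξ η₁ η₂ => by ext; simp [formRight_tmul])
    (fun z ξ η => by ext; simp [formRight_tmul]))

theorem form_tmul_tmul (ξ ξ' : E) (η η' : F) :
    form E φ (ξ ⊗ₜ η) (ξ' ⊗ₜ η') = inner Cᵐᵒᵖ η (φ (rinner B ξ ξ') η') := rfl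

theorem form_star (x y : E ⊗[ℂ] F) : star (form E φ x y) = form E φ y x := by
  induction x with
  | zero => simp
  | add x₁ x₂ h₁ h₂ => simp [h₁, h₂]
  | tmul ξ η =>
    induction y with
    | zero => simp
    | add y₁ y₂ h₁ h₂ => simp [h₁, h₂]
    | tmul ξ' η' =>
      rw [form_tmul_tmul, form_tmul_tmul, CStarModule.star_inner, ← star_rinner ξ' ξ, map_star,
        ← Adjointable.inner_adj]
      rfl

theorem form_op_smul (r : Cᵐᵒᵖ) (x y : E ⊗[ℂ] F) :
    form E φ x (TensorProduct.map LinearMap.id (opSMulLM r) y) = r * form E φ x y := by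
  induction x with
  | zero => simp
  | add x₁ x₂ h₁ h₂ => simp [h₁, h₂, mul_add]
  | tmul ξ η =>
    induction y with
    | zero => simp
    | add y₁ y₂ h₁ h₂ => simp only [map_add, h₁, h₂, mul_add]
    | tmul ξ' η' =>
      rw [TensorProduct.map_tmul, form_tmul_tmul, form_tmul_tmul, ← Adjointable.inner_adj,
        ← Adjointable.inner_adj]
      simp [opSMulLM]

theorem form_self_nonneg (x : E ⊗[ℂ] F) : 0 ≤ form E φ x x := by
  obtain ⟨s, rfl⟩ := TensorProduct.exists_finset x
  obtain ⟨N, hN⟩ := exists_gram_factor (B := B) (fun i : s => i.1.1)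
  have h : form E φ (∑ i ∈ s, i.1 ⊗ₜ[ℂ] i.2) (∑ i ∈ s, i.1 ⊗ₜ[ℂ] i.2)
      = ∑ k : s, inner Cᵐᵒᵖ (∑ i : s, φ (N k i) i.1.2) (∑ i : s, φ (N k i) i.1.2) := by
    rw [← Finset.sum_coe_sort s]
    simp only [map_sum, LinearMap.sum_apply, form_tmul_tmul, hN, CStarModule.inner_sum_left,
      CStarModule.inner_sum_right]
    have : ∀ i j : s, inner Cᵐᵒᵖ i.1.2 ((∑ k, φ (star (N k i) * N k j)).toCLM j.1.2)
        = ∑ k, inner Cᵐᵒᵖ (φ (N k i) i.1.2) (φ (N k j) j.1.2) := by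
      intro i j
      have h1 : (∑ k, φ (star (N k i) * N k j)).toCLM j.1.2
          = ∑ k, (φ (star (N k i) * N k j)) j.1.2 :=
        map_sum (AddMonoidHom.mk' (fun T : Adjointable C F F => T j.1.2)
          (fun S T => rfl)) _ _
      rw [h1, CStarModule.inner_sum_right]
      refine Finset.sum_congr rfl fun k _ => ?_
      rw [map_mul, map_star, ← Adjointable.inner_adj']
      rfl
    simp only [this]
    calc _ = ∑ i : s, ∑ k : s, ∑ j : s,
          inner Cᵐᵒᵖ (φ (N k i) i.1.2) (φ (N k j) j.1.2) := by
          rw [Finset.sum_comm]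
          exact Finset.sum_congr rfl fun i _ => Finset.sum_comm
      _ = _ := by
          rw [Finset.sum_comm]
          exact Finset.sum_congr rfl fun i _ => Finset.sum_comm
  rw [h]
  exact Finset.sum_nonneg fun k _ => CStarModule.inner_self_nonneg

instance : PreCStarModule Cᵐᵒᵖ (PreTensor E φ) where
  inner x y := form E φ x y
  inner_add_right := map_add _ _ _
  inner_self_nonneg := form_self_nonneg φ _
  inner_op_smul_right := form_op_smul φ _ _ _
  inner_smul_right_complex := map_smul _ _ _
  star_inner := form_star φ

instance : SeminormedAddCommGroup (PreTensor E φ) :=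
  PreCStarModule.seminormedAddCommGroup Cᵐᵒᵖ (PreTensor E φ)

instance : NormedSpace ℂ (PreTensor E φ) :=
  PreCStarModule.normedSpace Cᵐᵒᵖ (PreTensor E φ)

instance : PreCStarModule.NormCompat Cᵐᵒᵖ (PreTensor E φ) := ⟨fun _ => rfl⟩

instance : UniformContinuousConstSMul Cᵐᵒᵖ (PreTensor E φ) where
  uniformContinuous_const_smul r := by
    let f : PreTensor E φ →+ PreTensor E φ :=
      (TensorProduct.map (LinearMap.id : E →ₗ[ℂ] E) (opSMulLM (F := F) r)).toAddMonoidHom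
    exact (AddMonoidHomClass.lipschitz_of_bound f ‖r‖
      fun x => PreCStarModule.norm_op_smul_le r x).uniformContinuous

/-- The operator `T ⊗ 1` on the algebraic tensor product. -/
def mapLM (T : Adjointable B E E) : E ⊗[ℂ] F →ₗ[ℂ] E ⊗[ℂ] F :=
  TensorProduct.map (T.toCLM : E →ₗ[ℂ] E) LinearMap.id

theorem mapLM_tmul (T : Adjointable B E E) (ξ : E) (η : F) :
    mapLM T (ξ ⊗ₜ[ℂ] η) = T ξ ⊗ₜ[ℂ] η := rfl

theorem mapLM_mul (S T : Adjointable B E E) (x : E ⊗[ℂ] F) :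
    mapLM (S * T) x = mapLM S (mapLM T x) := by
  induction x with
  | zero => simp
  | add x₁ x₂ h₁ h₂ => simp [h₁, h₂]
  | tmul ξ η => simp [mapLM_tmul]

theorem mapLM_add (S T : Adjointable B E E) (x : E ⊗[ℂ] F) :
    mapLM (S + T) x = mapLM S x + mapLM T x := by
  induction x with
  | zero => simp
  | add x₁ x₂ h₁ h₂ => simp only [map_add, h₁, h₂]; abel
  | tmul ξ η => simp [mapLM_tmul, TensorProduct.add_tmul]

theorem mapLM_smul (z : ℂ) (T : Adjointable B E E) (x : E ⊗[ℂ] F) :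
    mapLM (z • T) x = z • mapLM T x := by
  induction x with
  | zero => simp
  | add x₁ x₂ h₁ h₂ => simp only [map_add, h₁, h₂, smul_add]
  | tmul ξ η => simp [mapLM_tmul, TensorProduct.smul_tmul']

theorem mapLM_one (x : E ⊗[ℂ] F) : mapLM (1 : Adjointable B E E) x = x := by
  induction x with
  | zero => simp
  | add x₁ x₂ h₁ h₂ => simp only [map_add, h₁, h₂]
  | tmul ξ η => simp [mapLM_tmul]

theorem form_mapLM (T : Adjointable B E E) (x y : E ⊗[ℂ] F) :
    form E φ (mapLM (star T) x) y = form E φ x (mapLM T y) := by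
  induction x with
  | zero => simp
  | add x₁ x₂ h₁ h₂ => simp [h₁, h₂]
  | tmul ξ η =>
    induction y with
    | zero => simp
    | add y₁ y₂ h₁ h₂ => simp [h₁, h₂]
    | tmul ξ' η' =>
      rw [mapLM_tmul, mapLM_tmul, form_tmul_tmul, form_tmul_tmul, rinner, rinner,
        ← T.inner_adj]
      rfl

theorem form_mapLM' (T : Adjointable B E E) (x y : E ⊗[ℂ] F) :
    form E φ (mapLM T x) y = form E φ x (mapLM (star T) y) := by
  conv_lhs => rw [← star_star T]
  exact form_mapLM φ (star T) x y

theorem norm_form_mapLM_le [CompleteSpace E] (T : Adjointable B E E) (x : E ⊗[ℂ] F) :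
    ‖form E φ (mapLM T x) (mapLM T x)‖ ≤ ‖T‖ ^ 2 * ‖form E φ x x‖ := by
  obtain ⟨c, hc⟩ : ∃ c : Adjointable B E E, ((‖T‖ ^ 2 : ℝ) : ℂ) • 1 - star T * T = star c * c := by
    let _ : PartialOrder (Adjointable B E E) := CStarAlgebra.spectralOrder _
    have _ : StarOrderedRing (Adjointable B E E) := CStarAlgebra.spectralOrderedRing _
    refine CStarAlgebra.nonneg_iff_eq_star_mul_self.mp (sub_nonneg.mpr ?_)
    have h := IsSelfAdjoint.le_algebraMap_norm_self (IsSelfAdjoint.star_mul_self T)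
    rw [CStarRing.norm_star_mul_self, ← sq, Algebra.algebraMap_eq_smul_one] at h
    refine h.trans_eq ?_
    rw [← Complex.coe_smul]
  have h1 : form E φ (mapLM T x) (mapLM T x) = form E φ x (mapLM (star T * T) x) := by
    rw [mapLM_mul, form_mapLM']
  have h2 : star T * T = ((‖T‖ ^ 2 : ℝ) : ℂ) • 1 + (-1 : ℂ) • (star c * c) := by
    rw [← hc]; module
  have h3 : form E φ (mapLM T x) (mapLM T x) ≤ (‖T‖ ^ 2) • form E φ x x := by
    rw [h1, h2, mapLM_add, mapLM_smul, mapLM_smul, mapLM_one, map_add, map_smul, map_smul,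
      mapLM_mul, ← form_mapLM']
    have h4 := form_self_nonneg φ (mapLM c x)
    rw [neg_one_smul, ← sub_eq_add_neg]
    refine (sub_le_self _ h4).trans_eq ?_
    rw [← Complex.coe_smul]
  have h5 := CStarAlgebra.norm_le_norm_of_nonneg_of_le (form_self_nonneg φ _) h3
  rwa [norm_smul, Real.norm_of_nonneg (sq_nonneg _)] at h5

/-- `T ⊗ 1` as a bounded operator for the seminorm. -/
def mapCLM [CompleteSpace E] (T : Adjointable B E E) : PreTensor E φ →L[ℂ] PreTensor E φ :=
  LinearMap.mkContinuous
    { toFun := fun x => mapLM T x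
      map_add' := fun x y => map_add (mapLM T) x y
      map_smul' := fun z x => map_smul (mapLM T) z x } ‖T‖ fun x => by
    refine le_of_sq_le_sq ?_ (by positivity)
    rw [mul_pow, PreCStarModule.norm_sq (R := Cᵐᵒᵖ), PreCStarModule.norm_sq (R := Cᵐᵒᵖ) x]
    exact norm_form_mapLM_le φ T x

end PreTensor

variable (E) in
/-- The interior tensor product `E ⊗_B F`, a Hilbert `C`-module: the completion of `E ⊗ F`. -/
abbrev InteriorTensor (φ : B →⋆ₙₐ[ℂ] Adjointable C F F) : Type _ := Completion (PreTensor E φ)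

namespace InteriorTensor
variable (φ : B →⋆ₙₐ[ℂ] Adjointable C F F)

instance : CStarModule Cᵐᵒᵖ (InteriorTensor E φ) :=
  PreCStarModule.completionCStarModule inferInstance

/-- The elementary tensor `ξ ⊗ η` in `E ⊗_B F`. -/
def tmul (ξ : E) (η : F) : InteriorTensor E φ :=
  ((PreTensor.mk φ ξ η : PreTensor E φ) : Completion (PreTensor E φ))

theorem inner_tmul_tmul (ξ ξ' : E) (η η' : F) :
    inner Cᵐᵒᵖ (tmul φ ξ η) (tmul φ ξ' η') = inner Cᵐᵒᵖ η (φ (rinner B ξ ξ') η') :=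
  PreCStarModule.completion_inner_coe _ _

variable {φ} in
theorem induction {p : InteriorTensor E φ → Prop} (x : InteriorTensor E φ)
    (closed : IsClosed {x | p x}) (zero : p 0) (tmul : ∀ ξ η, p (tmul φ ξ η))
    (add : ∀ x y, p x → p y → p (x + y)) : p x := by
  refine Completion.induction_on x closed fun a => ?_
  induction a using PreTensor.induction with
  | zero => exact zero
  | tmul ξ η => exact tmul ξ η
  | add x y hx hy => rw [Completion.coe_add]; exact add _ _ hx hy

/-- The adjointable operator `T ⊗ 1` on `E ⊗_B F`. -/
def mapAdjointable [CompleteSpace E] (T : Adjointable B E E) :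
    Adjointable C (InteriorTensor E φ) (InteriorTensor E φ) where
  toCLM := (PreTensor.mapCLM φ T).completion
  adj := (PreTensor.mapCLM φ (star T)).completion
  inner_adj x y := by
    refine Completion.induction_on₂ x y (isClosed_eq ?_ ?_) fun a b => ?_
    · exact PreCStarModule.Continuous.completion_inner
        ((ContinuousLinearMap.continuous _).comp continuous_snd) continuous_fst
    · exact PreCStarModule.Continuous.completion_inner continuous_snd
        ((ContinuousLinearMap.continuous _).comp continuous_fst)
    · rw [ContinuousLinearMap.completion_apply_coe, ContinuousLinearMap.completion_apply_coe,
        PreCStarModule.completion_inner_coe, PreCStarModule.completion_inner_coe]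
      exact PreTensor.form_mapLM φ T b a

theorem mapAdjointable_tmul [CompleteSpace E] (T : Adjointable B E E) (ξ : E) (η : F) :
    mapAdjointable φ T (tmul φ ξ η) = tmul φ (T ξ) η :=
  ContinuousLinearMap.completion_apply_coe _ _

theorem tmul_add_left (ξ₁ ξ₂ : E) (η : F) :
    tmul φ (ξ₁ + ξ₂) η = tmul φ ξ₁ η + tmul φ ξ₂ η := by
  unfold tmul
  rw [← Completion.coe_add]
  exact congrArg _ (TensorProduct.add_tmul ξ₁ ξ₂ η)

theorem tmul_smul_left (z : ℂ) (ξ : E) (η : F) :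
    tmul φ (z • ξ) η = z • tmul φ ξ η := by
  unfold tmul
  rw [← Completion.coe_smul]
  rfl

theorem ext_tmul {S T : Adjointable C (InteriorTensor E φ) (InteriorTensor E φ)}
    (h : ∀ ξ η, S (tmul φ ξ η) = T (tmul φ ξ η)) : S = T := by
  ext x
  induction x using induction with
  | closed => exact isClosed_eq S.toCLM.continuous T.toCLM.continuous
  | zero => rw [map_zero, map_zero]
  | tmul ξ η => exact h ξ η
  | add x y hx hy => rw [map_add, map_add, hx, hy]

/-- The ⋆-homomorphism `𝔹(E) → 𝔹(E ⊗_B F)`, `T ↦ T ⊗ 1`. -/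
def mapHom [CompleteSpace E] :
    Adjointable B E E →⋆ₙₐ[ℂ] Adjointable C (InteriorTensor E φ) (InteriorTensor E φ) where
  toFun := mapAdjointable φ
  map_smul' z T := ext_tmul φ fun ξ η => by
    rw [mapAdjointable_tmul, Adjointable.smul_apply, tmul_smul_left]
    exact congrArg _ (mapAdjointable_tmul φ T ξ η).symm
  map_zero' := ext_tmul φ fun ξ η => by
    rw [mapAdjointable_tmul, Adjointable.zero_apply, Adjointable.zero_apply]
    have := tmul_smul_left φ 0 (0 : E) η
    rwa [zero_smul, zero_smul] at this
  map_add' S T := ext_tmul φ fun ξ η => by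
    rw [mapAdjointable_tmul, Adjointable.add_apply, Adjointable.add_apply, tmul_add_left,
      mapAdjointable_tmul, mapAdjointable_tmul]
  map_mul' S T := ext_tmul φ fun ξ η => by
    rw [mapAdjointable_tmul, Adjointable.mul_apply, Adjointable.mul_apply,
      mapAdjointable_tmul, mapAdjointable_tmul]
  map_star' T := rfl

end InteriorTensor
end Tensor

/-! ### Correspondences, representations, transformations -/

section Correspondence

/-- A C⋆-algebra `O`, with `O` acting by right multiplication and with `⟪x, y⟫ = x⋆ y`, is a
Hilbert module over itself. -/
instance instCStarModuleSelf {O : Type*} [NonUnitalCStarAlgebra O] [PartialOrder O]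
    [StarOrderedRing O] : CStarModule Oᵐᵒᵖ O where
  inner x y := MulOpposite.op (star x * y)
  inner_add_right := by simp [mul_add]
  inner_self_nonneg {x} := star_mul_self_nonneg x
  inner_self {x} := by simp
  inner_op_smul_right {r x y} := MulOpposite.unop_injective (by simp [mul_assoc])
  inner_smul_right_complex {z x y} := MulOpposite.unop_injective (by simp [mul_smul_comm])
  star_inner x y := MulOpposite.unop_injective (by simp)
  norm_eq_sqrt_norm_inner_self x := by
    rw [MulOpposite.norm_op, CStarRing.norm_star_mul_self, Real.sqrt_mul_self (norm_nonneg _)]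

/-- The action of a C⋆-algebra `O` by left multiplication on the Hilbert module `O`. -/
def leftMul (O : Type*) [NonUnitalCStarAlgebra O] [PartialOrder O] [StarOrderedRing O] :
    O →⋆ₙₐ[ℂ] Adjointable O O O where
  toFun a :=
    { toCLM := ContinuousLinearMap.mul ℂ O a
      adj := ContinuousLinearMap.mul ℂ O (star a)
      inner_adj := fun x y => by
        change MulOpposite.op (star (star a * y) * x) = MulOpposite.op (star y * (a * x))
        rw [star_mul, star_star, mul_assoc] }
  map_smul' z a := Adjointable.ext fun x => smul_mul_assoc z a x
  map_zero' := Adjointable.ext fun x => zero_mul x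
  map_add' a b := Adjointable.ext fun x => add_mul a b x
  map_mul' a b := Adjointable.ext fun x => mul_assoc a b x
  map_star' a := Adjointable.ext fun x => rfl

variable {A B C E F G : Type*}
  [NonUnitalCStarAlgebra A]
  [NonUnitalCStarAlgebra B] [PartialOrder B] [StarOrderedRing B]
  [NonUnitalCStarAlgebra C] [PartialOrder C] [StarOrderedRing C]
  [NormedAddCommGroup E] [NormedSpace ℂ E] [SMul Bᵐᵒᵖ E] [CStarModule Bᵐᵒᵖ E]
  [NormedAddCommGroup F] [NormedSpace ℂ F] [SMul Cᵐᵒᵖ F] [CStarModule Cᵐᵒᵖ F]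
  [NormedAddCommGroup G] [NormedSpace ℂ G] [SMul Cᵐᵒᵖ G] [CStarModule Cᵐᵒᵖ G]

/-- The left action of a C⋆-algebra on a Hilbert module is nondegenerate if `A · F` spans a dense
subspace. A correspondence from `A` to `C` is a (complete) Hilbert `C`-module `F` together with a
nondegenerate ⋆-homomorphism `φ : A → 𝔹(F)`. -/
def IsNondegenerateAction (φ : A →⋆ₙₐ[ℂ] Adjointable C F F) : Prop :=
  Dense (Submodule.span ℂ {y : F | ∃ (a : A) (x : F), y = φ a x} : Set F)

/-- A correspondence is proper if the left action is by compact operators. -/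
def IsProper [CompleteSpace E] (φ : A →⋆ₙₐ[ℂ] Adjointable B E E) : Prop :=
  ∀ a, φ a ∈ compactOperators B E

/-- A (Toeplitz) representation of a correspondence `E` from `A` to `B`, by adjointable operators
from a correspondence `F` (from `B` to `C`) to a correspondence `G` (from `A` to `C`):
a linear map `S : E → 𝔹(F, G)` with `S(aξ) = a S(ξ)` and `S(ξ)⋆ S(η) = ⟪ξ, η⟫`. -/
structure IsRepresentation (φE : A →⋆ₙₐ[ℂ] Adjointable B E E) (φF : B →⋆ₙₐ[ℂ] Adjointable C F F)
    (φG : A →⋆ₙₐ[ℂ] Adjointable C G G) (S : E →ₗ[ℂ] Adjointable C F G) : Prop where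
  map_left : ∀ a ξ, S (φE a ξ) = (φG a).comp (S ξ)
  adjoint_comp : ∀ ξ η, (S ξ).adjoint.comp (S η) = φF (rinner B ξ η)

/-- A representation is nondegenerate if `S(E) · F` spans a dense subspace of `G`. -/
def IsNondegenerateRep (S : E →ₗ[ℂ] Adjointable C F G) : Prop :=
  Dense (Submodule.span ℂ {y : G | ∃ (ξ : E) (x : F), y = S ξ x} : Set G)

/-- A representation `S` is Cuntz–Pimsner covariant if `ϑ(φE(a)) = φG(a)` for all `a` such that
`φE(a)` is compact, where `ϑ : 𝕂(E) → 𝔹(G)` is the ⋆-homomorphism with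
`ϑ(|ξ⟩⟨η|) = S(ξ) S(η)⋆` (which is unique because ⋆-homomorphisms are continuous and the
`|ξ⟩⟨η|` span a dense subspace of `𝕂(E)`). -/
def IsCuntzPimsnerCovariant [CompleteSpace E] (φE : A →⋆ₙₐ[ℂ] Adjointable B E E)
    (φG : A →⋆ₙₐ[ℂ] Adjointable C G G) (S : E →ₗ[ℂ] Adjointable C F G) : Prop :=
  ∃ ϑ : compactOperators B E →⋆ₙₐ[ℂ] Adjointable C G G,
    (∀ ξ η, ϑ ⟨rankOne ξ η, rankOne_mem ξ η⟩ = (S ξ).comp (S η).adjoint) ∧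
    ∀ a (h : φE a ∈ compactOperators B E), ϑ ⟨φE a, h⟩ = φG a

/-- The left action `a · (ξ ⊗ η) = aξ ⊗ η` of `A` on `E ⊗_B F`. -/
def tensorAction [CompleteSpace E] (φE : A →⋆ₙₐ[ℂ] Adjointable B E E)
    (φF : B →⋆ₙₐ[ℂ] Adjointable C F F) :
    A →⋆ₙₐ[ℂ] Adjointable C (InteriorTensor E φF) (InteriorTensor E φF) :=
  (InteriorTensor.mapHom φF).comp φE

/-- An isomorphism of correspondences from `A` to `C`: a bijective `A, C`-bimodule map that
preserves the `C`-valued inner products. -/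
structure CorrespondenceIso (φF : A →⋆ₙₐ[ℂ] Adjointable C F F)
    (φG : A →⋆ₙₐ[ℂ] Adjointable C G G) extends F ≃ₗ[ℂ] G where
  map_left : ∀ a x, toFun (φF a x) = φG a (toFun x)
  map_right : ∀ (c : C) x, toFun (MulOpposite.op c • x) = MulOpposite.op c • toFun x
  inner_map : ∀ x y, rinner C (toFun x) (toFun y) = rinner C x y

instance (φF : A →⋆ₙₐ[ℂ] Adjointable C F F) (φG : A →⋆ₙₐ[ℂ] Adjointable C G G) :
    CoeFun (CorrespondenceIso φF φG) fun _ => F → G := ⟨fun u => u.toFun⟩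

/-- The composite of a linear map `S : E → D` with a ⋆-homomorphism `ψ` on `D`. -/
def compRep {D D' E : Type*} [NonUnitalCStarAlgebra D] [NonUnitalCStarAlgebra D']
    [AddCommGroup E] [Module ℂ E] (ψ : D →⋆ₙₐ[ℂ] D') (S : E →ₗ[ℂ] D) : E →ₗ[ℂ] D' where
  toFun ξ := ψ (S ξ)
  map_add' ξ η := by rw [map_add, map_add]
  map_smul' z ξ := by rw [map_smul, map_smul, RingHom.id_apply]

end Correspondence

/-! ### Universal properties -/

section Universal

variable {A E O : Type u} [NonUnitalCStarAlgebra A] [PartialOrder A] [StarOrderedRing A]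
  [NormedAddCommGroup E] [NormedSpace ℂ E] [CompleteSpace E] [SMul Aᵐᵒᵖ E] [CStarModule Aᵐᵒᵖ E]
  [NonUnitalCStarAlgebra O]

/-- Cuntz–Pimsner covariant representations `(φ, S)` of a correspondence `E` from `A` to itself
in a C⋆-algebra `D`. -/
structure IsCovariantRepIn {D : Type u} [NonUnitalCStarAlgebra D]
    (φE : A →⋆ₙₐ[ℂ] Adjointable A E E) (φ : A →⋆ₙₐ[ℂ] D) (S : E →ₗ[ℂ] D) : Prop where
  map_left : ∀ a ξ, S (φE a ξ) = φ a * S ξ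
  star_mul : ∀ ξ η, star (S ξ) * S η = φ (rinner A ξ η)
  covariant : ∃ ϑ : compactOperators A E →⋆ₙₐ[ℂ] D,
    (∀ ξ η, ϑ ⟨rankOne ξ η, rankOne_mem ξ η⟩ = S ξ * star (S η)) ∧
    ∀ a (h : φE a ∈ compactOperators A E), ϑ ⟨φE a, h⟩ = φ a

/-- `(O, φ₀, S₀)` is the (absolute) Cuntz–Pimsner algebra of the correspondence `E`: the universal
C⋆-algebra for Cuntz–Pimsner covariant representations of `E` in C⋆-algebras. -/
structure IsCuntzPimsnerAlgebra (φE : A →⋆ₙₐ[ℂ] Adjointable A E E)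
    (φ₀ : A →⋆ₙₐ[ℂ] O) (S₀ : E →ₗ[ℂ] O) : Prop where
  isRep : IsCovariantRepIn φE φ₀ S₀
  existsUnique : ∀ (D : Type u) [NonUnitalCStarAlgebra D] (φ : A →⋆ₙₐ[ℂ] D) (S : E →ₗ[ℂ] D),
    IsCovariantRepIn φE φ S →
      ∃! ψ : O →⋆ₙₐ[ℂ] D, (∀ a, ψ (φ₀ a) = φ a) ∧ ∀ ξ, ψ (S₀ ξ) = S ξ

variable [PartialOrder O] [StarOrderedRing O]

/-- `(O, φ₀, S₀)` is universal for nondegenerate representations of `E` on correspondences: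
`(φ₀, S₀)` is itself a nondegenerate representation of `E`, on the correspondence `O` from `A` to
`O`, and composition with `φ₀` and `S₀` is a bijection from nondegenerate representations of `O`
on a Hilbert module `F` to nondegenerate representations of `E` on correspondences with underlying
Hilbert module `F`. -/
structure IsUniversalNondegenerateRep (φE : A →⋆ₙₐ[ℂ] Adjointable A E E)
    (φ₀ : A →⋆ₙₐ[ℂ] O) (S₀ : E →ₗ[ℂ] O) : Prop where
  nondegenerate_action : IsNondegenerateAction ((leftMul O).comp φ₀)
  isRep : IsRepresentation φE ((leftMul O).comp φ₀) ((leftMul O).comp φ₀)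
    (compRep (leftMul O) S₀)
  nondegenerate_rep : IsNondegenerateRep (compRep (leftMul O) S₀)
  existsUnique : ∀ (B F : Type u) [NonUnitalCStarAlgebra B] [PartialOrder B] [StarOrderedRing B]
    [NormedAddCommGroup F] [NormedSpace ℂ F] [CompleteSpace F] [SMul Bᵐᵒᵖ F] [CStarModule Bᵐᵒᵖ F]
    (φ : A →⋆ₙₐ[ℂ] Adjointable B F F) (S : E →ₗ[ℂ] Adjointable B F F),
    IsNondegenerateAction φ → IsRepresentation φE φ φ S → IsNondegenerateRep S →
      ∃! ψ : O →⋆ₙₐ[ℂ] Adjointable B F F, IsNondegenerateAction ψ ∧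
        (∀ a, ψ (φ₀ a) = φ a) ∧ ∀ ξ, ψ (S₀ ξ) = S ξ
  comp : ∀ (B F : Type u) [NonUnitalCStarAlgebra B] [PartialOrder B] [StarOrderedRing B]
    [NormedAddCommGroup F] [NormedSpace ℂ F] [CompleteSpace F] [SMul Bᵐᵒᵖ F] [CStarModule Bᵐᵒᵖ F]
    (ψ : O →⋆ₙₐ[ℂ] Adjointable B F F), IsNondegenerateAction ψ →
      IsNondegenerateAction (ψ.comp φ₀) ∧
      IsRepresentation φE (ψ.comp φ₀) (ψ.comp φ₀) (compRep ψ S₀) ∧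
      IsNondegenerateRep (compRep ψ S₀)

/-- Let `u₀ : E ⊗_A O ≅ O` be a transformation from `(A, E)` to `O`, and let `F` be a
correspondence from `O` to `B`, with left action `ψ`, viewed also as a correspondence from `A` to
`B` through the action `φ = ψ ∘ φ₀`. This says that `u : E ⊗_A F ≅ F` equals `u₀ ⊗_ψ id_F` under
the canonical isomorphisms
`E ⊗_A F ≅ E ⊗_A O ⊗_O F`, `ξ ⊗ ψ(x)η ↦ ξ ⊗ x ⊗ η`, and `O ⊗_O F ≅ F`, `x ⊗ η ↦ ψ(x)η`. -/
def IsInducedTransformation {B F : Type u} [NonUnitalCStarAlgebra B] [PartialOrder B]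
    [StarOrderedRing B] [NormedAddCommGroup F] [NormedSpace ℂ F] [SMul Bᵐᵒᵖ F] [CStarModule Bᵐᵒᵖ F]
    {φE : A →⋆ₙₐ[ℂ] Adjointable A E E} {φ₀ : A →⋆ₙₐ[ℂ] O}
    (u₀ : CorrespondenceIso (tensorAction φE ((leftMul O).comp φ₀)) ((leftMul O).comp φ₀))
    (ψ : O →⋆ₙₐ[ℂ] Adjointable B F F) {φ : A →⋆ₙₐ[ℂ] Adjointable B F F}
    (u : CorrespondenceIso (tensorAction φE φ) φ) : Prop :=
  ∀ (ξ : E) (x : O) (η : F),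
    u (InteriorTensor.tmul φ ξ (ψ x η)) = ψ (u₀ (InteriorTensor.tmul _ ξ x)) η

/-- `(O, u₀)` is a universal transformation from `(A, E)`. A transformation from `(A, E)` to a
C⋆-algebra `B` is a correspondence `F` from `A` to `B` with an isomorphism of correspondences
`u : E ⊗_A F ≅ F`. The universal property says that `ψ ↦ u₀ ⊗_ψ id_F` is a bijection from
nondegenerate representations of `O` on `F` (correspondences from `O` to `B`) to transformations
with underlying Hilbert module `F`. -/
structure IsUniversalTransformation (φE : A →⋆ₙₐ[ℂ] Adjointable A E E) (φ₀ : A →⋆ₙₐ[ℂ] O)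
    (u₀ : CorrespondenceIso (tensorAction φE ((leftMul O).comp φ₀)) ((leftMul O).comp φ₀)) :
    Prop where
  nondegenerate_action : IsNondegenerateAction ((leftMul O).comp φ₀)
  existsUnique : ∀ (B F : Type u) [NonUnitalCStarAlgebra B] [PartialOrder B] [StarOrderedRing B]
    [NormedAddCommGroup F] [NormedSpace ℂ F] [CompleteSpace F] [SMul Bᵐᵒᵖ F] [CStarModule Bᵐᵒᵖ F]
    (φ : A →⋆ₙₐ[ℂ] Adjointable B F F) (u : CorrespondenceIso (tensorAction φE φ) φ),
    IsNondegenerateAction φ →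
      ∃! ψ : O →⋆ₙₐ[ℂ] Adjointable B F F, IsNondegenerateAction ψ ∧
        (∀ a, ψ (φ₀ a) = φ a) ∧ IsInducedTransformation u₀ ψ u
  comp : ∀ (B F : Type u) [NonUnitalCStarAlgebra B] [PartialOrder B] [StarOrderedRing B]
    [NormedAddCommGroup F] [NormedSpace ℂ F] [CompleteSpace F] [SMul Bᵐᵒᵖ F] [CStarModule Bᵐᵒᵖ F]
    (ψ : O →⋆ₙₐ[ℂ] Adjointable B F F), IsNondegenerateAction ψ →
      IsNondegenerateAction (ψ.comp φ₀) ∧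
      ∃! u : CorrespondenceIso (tensorAction φE (ψ.comp φ₀)) (ψ.comp φ₀),
        IsInducedTransformation u₀ ψ u

end Universal

end

/-! The hinge is the interior tensor product. The relation S(ξ)⋆S(η) = ⟪ξ, η⟫ says exactly that ξ ⊗
x ↦ S(ξ)x preserves inner products, so it extends to an isometry E ⊗ F → G, and S is nondegenerate
precisely when this isometry is a unitary u. Hence nondegenerate representations and isomorphisms of
correspondences E ⊗ F ≅ G are the same data (`exists_correspondenceIso`, `toRep`), which is the
bridge to transformations.

For a nondegenerate S, T ↦ u(T ⊗ 1)u⋆ is a ⋆-homomorphism θ on 𝔹(E) with θ(T)S(ξ)x = S(Tξ)x. On the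
dense subspace S(E)F one reads off θ(|ξ⟩⟨η|) = S(ξ)S(η)⋆ and θ(φE(a)) = φG(a), so S is covariant.
Conversely, if E is proper and S is covariant, each φG(a) = ϑ(φE(a)) is a limit of sums of operators
S(ξ)S(η)⋆; as φG(A)G is dense, so is the span of S(E)F.

The Cuntz–Pimsner algebra is generated by a product of covariant representations, one for each
seminorm such a representation induces on a free algebra; there is only a set of these, and all
coordinates are uniformly bounded.

Its universal property concerns homomorphisms into arbitrary C⋆-algebras D, whereas the other one
concerns nondegenerate actions on Hilbert modules. Passing to actions uses the first part and the
density of φ₀(A)O in O. Passing back, a covariant representation in D generates a subalgebra T,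
which acts on itself, and one gets O → 𝔹(T), that is, into multipliers. It lands in T once O is
known to be generated by φ₀(A) and S₀(E). That generation is the delicate point
(`surjective_of_generatedAlgebra_eq_top`): uniqueness shows that the generated subalgebra is an
ideal of O, and a closed ideal containing the dense set φ₀(A)O is everything.

For a transformation u₀ on O, the operators x ↦ u₀(ξ ⊗ x) are a priori only multipliers of O. Since
T(aξ) = φ₀(a)T(ξ) and E is the closed span of AE, they lie in O (`exists_linearMap`). -/

noncomputable section

open scoped CStarAlgebra ENNReal
open Filter Topology
open scoped TensorProduct

/-! ### Approximate units and equality tests in Hilbert modules -/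

section HilbertModule
variable {R X : Type*} [NonUnitalCStarAlgebra R] [PartialOrder R] [StarOrderedRing R]
  [NormedAddCommGroup X] [NormedSpace ℂ X] [SMul R X] [CStarModule R X]

namespace HilbertModule

/-- Expanding the inner product gives ‖rx − x‖² ≤ 2‖r⟪x, x⟫ − ⟪x, x⟫‖ for ‖r‖ ≤ 1, which reduces
convergence to that in R. It supplies the density of E · A in E, later needed for the adjoints
S(ξ)⋆. -/
theorem tendsto_approximateUnit_smul (x : X) :
    Tendsto (fun r : R => r • x) (CStarAlgebra.approximateUnit R) (𝓝 x) := by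
  have hU := CStarAlgebra.increasingApproximateUnit R
  rw [tendsto_iff_norm_sub_tendsto_zero]
  have h1 : Tendsto (fun r : R => √(2 * ‖r * inner R x x - inner R x x‖))
      (CStarAlgebra.approximateUnit R) (𝓝 0) := by
    have h2 := tendsto_iff_norm_sub_tendsto_zero.mp (hU.tendsto_mul_right (inner R x x))
    simpa using (h2.const_mul 2).sqrt
  refine squeeze_zero' (Eventually.of_forall fun _ => norm_nonneg _) ?_ h1
  filter_upwards [hU.eventually_norm] with r hr
  refine Real.le_sqrt_of_sq_le ?_
  rw [CStarModule.norm_sq_eq R]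
  have h3 : inner R (r • x - x) (r • x - x)
      = (r * inner R x x - inner R x x) * star r - (r * inner R x x - inner R x x) := by
    simp only [CStarModule.inner_sub_right, CStarModule.inner_sub_left,
      CStarModule.inner_op_smul_right, CStarModule.inner_op_smul_left, sub_mul, mul_sub, mul_assoc]
    abel
  rw [h3]
  calc _ ≤ ‖r * inner R x x - inner R x x‖ * ‖star r‖ + ‖r * inner R x x - inner R x x‖ :=
        (norm_sub_le _ _).trans (by gcongr; exact norm_mul_le _ _)
    _ ≤ ‖r * inner R x x - inner R x x‖ * 1 + ‖r * inner R x x - inner R x x‖ := by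
        rw [norm_star]; gcongr
    _ = _ := by ring

/-- Pairing with x and y alone suffices. This serves degenerate representations, where only inner
products between vectors of the form S(ξ)x are computable. -/
theorem eq_of_forall_inner {x y : X} (h : inner R x x = inner R x y)
    (h' : inner R y x = inner R y y) : x = y := by
  have h2 : inner R (x - y) (x - y) = 0 := by
    rw [CStarModule.inner_sub_right, CStarModule.inner_sub_left, CStarModule.inner_sub_left,
      h, h', sub_self]
  exact sub_eq_zero.mp (CStarModule.inner_self.mp h2)

end HilbertModule
end HilbertModule

namespace Adjointable
variable {B F G : Type*} [NonUnitalCStarAlgebra B] [PartialOrder B] [StarOrderedRing B]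
  [NormedAddCommGroup F] [NormedSpace ℂ F] [SMul Bᵐᵒᵖ F] [CStarModule Bᵐᵒᵖ F]
  [NormedAddCommGroup G] [NormedSpace ℂ G] [SMul Bᵐᵒᵖ G] [CStarModule Bᵐᵒᵖ G]

theorem norm_apply_le (T : Adjointable B F G) (x : F) : ‖T x‖ ≤ ‖T‖ * ‖x‖ := T.toCLM.le_opNorm x

/-- Evaluation at a vector. -/
def applyCLM (x : F) : Adjointable B F G →L[ℂ] G :=
  LinearMap.mkContinuous
    { toFun := fun T => T x
      map_add' := fun _ _ => rfl
      map_smul' := fun _ _ => rfl } ‖x‖ fun T => (T.norm_apply_le x).trans_eq (mul_comm _ _)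

theorem eq_of_eqOn_span {S T : Adjointable B F G} {s : Set F}
    (hs : Dense (Submodule.span ℂ s : Set F)) (h : ∀ x ∈ s, S x = T x) : S = T := by
  refine toCLM_injective (ContinuousLinearMap.ext_on hs h)

end Adjointable

/-! ### Nondegenerate actions and dense spans -/

section Nondegenerate
variable {A C F : Type*} [NonUnitalCStarAlgebra A]
  [NonUnitalCStarAlgebra C] [PartialOrder C] [StarOrderedRing C]
  [NormedAddCommGroup F] [NormedSpace ℂ F] [SMul Cᵐᵒᵖ F] [CStarModule Cᵐᵒᵖ F]

theorem dense_span_of_subset_closure {V : Type*} [NormedAddCommGroup V] [NormedSpace ℂ V]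
    {s t : Set V} (hs : Dense (Submodule.span ℂ s : Set V))
    (h : s ⊆ (Submodule.span ℂ t).topologicalClosure) :
    Dense (Submodule.span ℂ t : Set V) := by
  rw [Submodule.dense_iff_topologicalClosure_eq_top] at hs ⊢
  rw [eq_top_iff, ← hs]
  exact Submodule.topologicalClosure_minimal _ (Submodule.span_le.mpr h)
    (Submodule.isClosed_topologicalClosure _)

theorem eq_of_isNondegenerateAction {G : Type*} [NormedAddCommGroup G] [NormedSpace ℂ G]
    [SMul Cᵐᵒᵖ G] [CStarModule Cᵐᵒᵖ G] {φ : A →⋆ₙₐ[ℂ] Adjointable C F F}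
    (hφ : IsNondegenerateAction φ) {S T : Adjointable C F G}
    (h : ∀ a x, S (φ a x) = T (φ a x)) : S = T :=
  Adjointable.eq_of_eqOn_span hφ fun _ ⟨a, x, hx⟩ => hx ▸ h a x

end Nondegenerate

/-! ### Identities that hold in every representation -/

section Representation
variable {A B C E F G : Type*}
  [NonUnitalCStarAlgebra A]
  [NonUnitalCStarAlgebra B] [PartialOrder B] [StarOrderedRing B]
  [NonUnitalCStarAlgebra C] [PartialOrder C] [StarOrderedRing C]
  [NormedAddCommGroup E] [NormedSpace ℂ E] [SMul Bᵐᵒᵖ E] [CStarModule Bᵐᵒᵖ E]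
  [NormedAddCommGroup F] [NormedSpace ℂ F] [SMul Cᵐᵒᵖ F] [CStarModule Cᵐᵒᵖ F]
  [NormedAddCommGroup G] [NormedSpace ℂ G] [SMul Cᵐᵒᵖ G] [CStarModule Cᵐᵒᵖ G]
  {φE : A →⋆ₙₐ[ℂ] Adjointable B E E} {φF : B →⋆ₙₐ[ℂ] Adjointable C F F}
  {φG : A →⋆ₙₐ[ℂ] Adjointable C G G} {S : E →ₗ[ℂ] Adjointable C F G}

theorem norm_rinner_self (ξ : E) : ‖rinner B ξ ξ‖ = ‖ξ‖ ^ 2 := by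
  rw [CStarModule.norm_sq_eq Bᵐᵒᵖ]; rfl

namespace IsRepresentation

theorem inner_apply (hS : IsRepresentation φE φF φG S) (ξ η : E) (x y : F) :
    inner Cᵐᵒᵖ (S ξ x) (S η y) = inner Cᵐᵒᵖ x (φF (rinner B ξ η) y) := by
  rw [← hS.adjoint_comp, ← (S ξ).inner_adj']
  rfl

/-- Right linearity is automatic: S(ξb)x and S(ξ)φF(b)x have equal inner products with themselves
and with each other, all given by ⟪ξ, ξb⟫ = ⟪ξ, ξ⟫b. -/
theorem map_op_smul (hS : IsRepresentation φE φF φG S) (ξ : E) (b : B) :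
    S (MulOpposite.op b • ξ) = (S ξ).comp (φF b) := by
  ext x
  refine HilbertModule.eq_of_forall_inner (R := Cᵐᵒᵖ) ?_ ?_
  · rw [Adjointable.comp_apply, hS.inner_apply, hS.inner_apply, rinner_op_smul_right, map_mul]
    rfl
  · rw [Adjointable.comp_apply, hS.inner_apply, hS.inner_apply, rinner_op_smul_right, map_mul]
    rfl

theorem norm_apply_le [CompleteSpace F] (hS : IsRepresentation φE φF φG S) (ξ : E) :
    ‖S ξ‖ ≤ ‖ξ‖ := by
  refine (S ξ).toCLM.opNorm_le_bound (norm_nonneg _) fun x => ?_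
  refine le_of_sq_le_sq ?_ (by positivity)
  rw [CStarModule.norm_sq_eq Cᵐᵒᵖ, hS.inner_apply]
  calc _ ≤ ‖x‖ * (‖rinner B ξ ξ‖ * ‖x‖) := by
        refine (CStarModule.norm_inner_le _).trans ?_
        gcongr
        refine (Adjointable.norm_apply_le _ _).trans ?_
        gcongr
        exact NonUnitalStarAlgHom.norm_apply_le φF _
    _ = _ := by rw [norm_rinner_self]; ring

/-- S(ξ)S(η)⋆S(ζ) = S(ξ)⟪η, ζ⟫ = S(ξ⟪η, ζ⟫): on the span of S(E)F the only possible value of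
ϑ(|ξ⟩⟨η|) is already correct. -/
theorem comp_adjoint_apply (hS : IsRepresentation φE φF φG S) (ξ η ζ : E) (x : F) :
    (S ξ).comp (S η).adjoint (S ζ x) = S (rankOne (B := B) ξ η ζ) x := by
  rw [rankOne_apply, ← op_rinner, hS.map_op_smul, ← hS.adjoint_comp]
  rfl

end IsRepresentation
end Representation

/-! ### Unitaries out of the interior tensor product -/

section Tensor
variable {A B C E F G : Type*}
  [NonUnitalCStarAlgebra A]
  [NonUnitalCStarAlgebra B] [PartialOrder B] [StarOrderedRing B]
  [NonUnitalCStarAlgebra C] [PartialOrder C] [StarOrderedRing C]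
  [NormedAddCommGroup E] [NormedSpace ℂ E] [SMul Bᵐᵒᵖ E] [CStarModule Bᵐᵒᵖ E]
  [NormedAddCommGroup F] [NormedSpace ℂ F] [SMul Cᵐᵒᵖ F] [CStarModule Cᵐᵒᵖ F]
  [NormedAddCommGroup G] [NormedSpace ℂ G] [SMul Cᵐᵒᵖ G] [CStarModule Cᵐᵒᵖ G]
  {φE : A →⋆ₙₐ[ℂ] Adjointable B E E} {φF : B →⋆ₙₐ[ℂ] Adjointable C F F}
  {φG : A →⋆ₙₐ[ℂ] Adjointable C G G} {S : E →ₗ[ℂ] Adjointable C F G}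

theorem HilbertModule.norm_eq_of_inner {v : F →L[ℂ] G}
    (hv : ∀ x y, inner Cᵐᵒᵖ (v x) (v y) = inner Cᵐᵒᵖ x y) (x : F) : ‖v x‖ = ‖x‖ := by
  rw [CStarModule.norm_eq_sqrt_norm_inner_self (A := Cᵐᵒᵖ), hv,
    ← CStarModule.norm_eq_sqrt_norm_inner_self]

theorem HilbertModule.isometry_of_inner {v : F →L[ℂ] G}
    (hv : ∀ x y, inner Cᵐᵒᵖ (v x) (v y) = inner Cᵐᵒᵖ x y) : Isometry v :=
  AddMonoidHomClass.isometry_of_norm v (norm_eq_of_inner hv)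

theorem HilbertModule.surjective_of_inner [CompleteSpace F] {v : F →L[ℂ] G}
    (hv : ∀ x y, inner Cᵐᵒᵖ (v x) (v y) = inner Cᵐᵒᵖ x y) (hd : DenseRange v) :
    Function.Surjective v := by
  rw [← Set.range_eq_univ, ← (isometry_of_inner hv).isClosedEmbedding.isClosed_range.closure_eq]
  exact hd.closure_range

/-- A surjective bimodule map that preserves inner products. -/
def CorrespondenceIso.ofSurjective {φ : A →⋆ₙₐ[ℂ] Adjointable C F F} (v : F →L[ℂ] G)
    (hv : ∀ x y, inner Cᵐᵒᵖ (v x) (v y) = inner Cᵐᵒᵖ x y) (hs : Function.Surjective v)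
    (hl : ∀ a x, v (φ a x) = φG a (v x)) : CorrespondenceIso φ φG where
  toLinearEquiv := LinearEquiv.ofBijective v.toLinearMap
    ⟨(HilbertModule.isometry_of_inner hv).injective, hs⟩
  map_left := hl
  map_right c x := by
    -- Right linearity follows from the inner products: as v is onto, it suffices to pair with
    -- vectors v w.
    refine HilbertModule.ext_inner (R := Cᵐᵒᵖ) fun w => ?_
    obtain ⟨w, rfl⟩ := hs w
    change inner Cᵐᵒᵖ (v w) (v _) = inner Cᵐᵒᵖ (v w) (_ • v x)
    rw [hv, CStarModule.inner_op_smul_right, CStarModule.inner_op_smul_right, hv]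
  inner_map x y := congrArg MulOpposite.unop (hv x y)

/-! ### Creation operators and their adjoints -/

namespace InteriorTensor

variable (φF) in
theorem tmul_add_right (ξ : E) (x y : F) :
    tmul φF ξ (x + y) = tmul φF ξ x + tmul φF ξ y := by
  unfold tmul
  rw [← Completion.coe_add]
  exact congrArg _ (TensorProduct.tmul_add ξ x y)

variable (φF) in
theorem tmul_smul_right (z : ℂ) (ξ : E) (x : F) :
    tmul φF ξ (z • x) = z • tmul φF ξ x := by
  unfold tmul
  rw [← Completion.coe_smul]
  exact congrArg _ (TensorProduct.tmul_smul z ξ x)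

theorem norm_tmul_le [CompleteSpace F] (ξ : E) (x : F) : ‖tmul φF ξ x‖ ≤ ‖ξ‖ * ‖x‖ := by
  refine le_of_sq_le_sq ?_ (by positivity)
  rw [CStarModule.norm_sq_eq Cᵐᵒᵖ, inner_tmul_tmul]
  calc _ ≤ ‖x‖ * (‖rinner B ξ ξ‖ * ‖x‖) := by
        refine (CStarModule.norm_inner_le _).trans ?_
        gcongr
        refine (Adjointable.norm_apply_le _ _).trans ?_
        gcongr
        exact NonUnitalStarAlgHom.norm_apply_le φF _
    _ = _ := by rw [norm_rinner_self]; ring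

theorem eqOn_tmul {V : Type*} [NormedAddCommGroup V] [NormedSpace ℂ V]
    {f g : InteriorTensor E φF →L[ℂ] V} (h : ∀ ξ x, f (tmul φF ξ x) = g (tmul φF ξ x)) :
    f = g := by
  ext x
  induction x using induction with
  | closed => exact isClosed_eq f.continuous g.continuous
  | zero => rw [map_zero, map_zero]
  | tmul ξ η => exact h ξ η
  | add x y hx hy => rw [map_add, map_add, hx, hy]

/-- The linear map `E ⊗ F → F`, `ξ' ⊗ x ↦ ⟪ξ, ξ'⟫ x`. -/
def preAnnihilate (φF : B →⋆ₙₐ[ℂ] Adjointable C F F) (ξ : E) :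
    PreTensor E φF →ₗ[ℂ] F :=
  TensorProduct.lift (LinearMap.mk₂ ℂ (fun ξ' x => φF (rinner B ξ ξ') x)
    (fun ξ₁ ξ₂ η' => by simp [rinner_add_right])
    (fun z ξ₁ η' => by simp [rinner_smul_right])
    (fun ξ₁ η₁ η₂ => by simp)
    (fun z ξ₁ η₁ => by simp))

/-- The adjointness relation between creation and annihilation by ξ on algebraic tensors; the bound
on annihilation and the adjoint of `creation` both come from it. -/
theorem inner_preAnnihilate (ξ : E) (y : F) (x : PreTensor E φF) :
    inner Cᵐᵒᵖ y (preAnnihilate φF ξ x) = inner Cᵐᵒᵖ (PreTensor.mk φF ξ y) x := by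
  induction x using PreTensor.induction with
  | zero =>
    rw [map_zero, CStarModule.inner_zero_right]
    exact (map_zero (PreTensor.form E φF (ξ ⊗ₜ y))).symm
  | add x₁ x₂ h₁ h₂ =>
    rw [map_add, CStarModule.inner_add_right, PreCStarModule.inner_add_right, h₁, h₂]
  | tmul ξ' z => rfl

/-- With Tx the annihilated vector, adjointness and Cauchy–Schwarz give ‖Tx‖² = ‖⟪ξ ⊗ Tx, x⟫‖ ≤
‖ξ‖‖Tx‖‖x‖; divide by ‖Tx‖. So T extends to the completion. -/
theorem norm_preAnnihilate_le [CompleteSpace F] (ξ : E) (x : PreTensor E φF) :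
    ‖preAnnihilate φF ξ x‖ ≤ ‖ξ‖ * ‖x‖ := by
  rcases (norm_nonneg (preAnnihilate φF ξ x)).eq_or_lt with h | h
  · rw [← h]; positivity
  · refine le_of_mul_le_mul_right ?_ h
    rw [← sq, CStarModule.norm_sq_eq Cᵐᵒᵖ, inner_preAnnihilate]
    have h1 := norm_tmul_le (φF := φF) ξ (preAnnihilate φF ξ x)
    have h2 := PreCStarModule.norm_inner_le (R := Cᵐᵒᵖ)
      (PreTensor.mk φF ξ (preAnnihilate φF ξ x)) x
    rw [tmul, Completion.norm_coe] at h1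
    calc _ ≤ _ := h2
      _ ≤ ‖ξ‖ * ‖preAnnihilate φF ξ x‖ * ‖x‖ := by gcongr
      _ = _ := by ring

/-- The creation operator `F → E ⊗_B F`, `x ↦ ξ ⊗ x`. -/
def creation [CompleteSpace F] (φF : B →⋆ₙₐ[ℂ] Adjointable C F F) (ξ : E) :
    Adjointable C F (InteriorTensor E φF) where
  toCLM := LinearMap.mkContinuous
    { toFun := fun x => tmul φF ξ x
      map_add' := tmul_add_right φF ξ
      map_smul' := fun z x => tmul_smul_right φF z ξ x } ‖ξ‖ (norm_tmul_le ξ)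
  adj := LinearMap.extendOfNorm (preAnnihilate φF ξ)
    (Completion.toComplL (𝕜 := ℂ) (E := PreTensor E φF)).toLinearMap
  inner_adj x y := by
    rw [← CStarModule.star_inner]
    refine (congrArg star ?_).trans (CStarModule.star_inner (A := Cᵐᵒᵖ)
      (tmul φF ξ x) y)
    have h (a : PreTensor E φF) : LinearMap.extendOfNorm (preAnnihilate φF ξ)
        (Completion.toComplL (𝕜 := ℂ) (E := PreTensor E φF)).toLinearMap
          (a : Completion (PreTensor E φF)) = preAnnihilate φF ξ a :=
      LinearMap.extendOfNorm_eq Completion.denseRange_coe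
        ⟨‖ξ‖, fun x => (norm_preAnnihilate_le ξ x).trans_eq (by
          rw [← Completion.norm_coe (x : PreTensor E φF)]; rfl)⟩ a
    refine Completion.induction_on y (isClosed_eq ?_ ?_) fun a => ?_
    · exact CStarModule.continuous_inner.comp (by fun_prop : Continuous
        fun w => (x, LinearMap.extendOfNorm _ _ w))
    · exact CStarModule.continuous_inner.comp (by fun_prop : Continuous
        fun w => (tmul φF ξ x, w))
    · rw [h, inner_preAnnihilate]
      exact (PreCStarModule.completion_inner_coe _ _).symm

@[simp] theorem creation_apply [CompleteSpace F] (ξ : E) (x : F) :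
    creation φF ξ x = tmul φF ξ x := rfl

end InteriorTensor

/-! ### From isomorphisms of correspondences to representations -/

namespace CorrespondenceIso
variable {φ : A →⋆ₙₐ[ℂ] Adjointable C F F}

theorem inner_map' (u : CorrespondenceIso φ φG) (x y : F) :
    inner Cᵐᵒᵖ (u x) (u y) = inner Cᵐᵒᵖ x y :=
  congrArg MulOpposite.op (u.inner_map x y)

theorem norm_map (u : CorrespondenceIso φ φG) (x : F) : ‖u x‖ = ‖x‖ := by
  rw [CStarModule.norm_eq_sqrt_norm_inner_self (A := Cᵐᵒᵖ), inner_map',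
    ← CStarModule.norm_eq_sqrt_norm_inner_self]

/-- An isomorphism of correspondences as a unitary operator. -/
def toAdjointable (u : CorrespondenceIso φ φG) : Adjointable C F G where
  toCLM := LinearMap.mkContinuous u.toLinearMap 1 fun x => by
    rw [one_mul]; exact (u.norm_map x).le
  adj := LinearMap.mkContinuous u.symm.toLinearMap 1 fun x => by
    rw [one_mul, ← u.norm_map]
    exact (congrArg norm (u.apply_symm_apply x)).le
  inner_adj x y := by
    change inner Cᵐᵒᵖ (u.symm y) x = inner Cᵐᵒᵖ y (u x)
    rw [← u.inner_map']
    congr 1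
    exact u.apply_symm_apply y

theorem adjoint_comp_toAdjointable (u : CorrespondenceIso φ φG) :
    u.toAdjointable.adjoint.comp u.toAdjointable = 1 :=
  Adjointable.ext fun x => u.symm_apply_apply x

theorem toAdjointable_injective :
    Function.Injective (toAdjointable : CorrespondenceIso φ φG → Adjointable C F G) := by
  rintro ⟨u, _, _, _⟩ ⟨v, _, _, _⟩ h
  have : u = v := LinearEquiv.ext fun x => congrArg (fun T : Adjointable C F G => T x) h
  subst this
  rfl

/-- Conjugation by a unitary. -/
def conjHom (u : CorrespondenceIso φ φG) : Adjointable C F F →⋆ₙₐ[ℂ] Adjointable C G G where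
  toFun T := u.toAdjointable.comp (T.comp u.toAdjointable.adjoint)
  map_smul' z T := Adjointable.ext fun x => map_smul u.toAdjointable.toCLM _ _
  map_zero' := Adjointable.ext fun x => map_zero u.toAdjointable.toCLM
  map_add' S T := Adjointable.ext fun x => map_add u.toAdjointable.toCLM _ _
  map_mul' S T := Adjointable.ext fun x => by
    -- Multiplicativity comes from cancelling u⋆u = 1 between S and T.
    have h := congrArg (fun R : Adjointable C F F => R (T (u.toAdjointable.adjoint x)))
      u.adjoint_comp_toAdjointable
    exact congrArg (fun y => u.toAdjointable (S y)) h.symm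
  map_star' T := rfl

theorem conjHom_apply (u : CorrespondenceIso φ φG) (T : Adjointable C F F) (x : F) :
    u.conjHom T (u x) = u (T x) := by
  have h := congrArg (fun R : Adjointable C F F => R x) u.adjoint_comp_toAdjointable
  exact congrArg (fun y => u.toAdjointable (T y)) h

/-- The linear map `ξ ↦ (x ↦ u (ξ ⊗ x))`. -/
def toRep [CompleteSpace E] [CompleteSpace F] (u : CorrespondenceIso (tensorAction φE φF) φG) :
    E →ₗ[ℂ] Adjointable C F G where
  toFun ξ := u.toAdjointable.comp (InteriorTensor.creation φF ξ)
  map_add' ξ η := Adjointable.ext fun x => by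
    simp only [Adjointable.comp_apply, InteriorTensor.creation_apply, Adjointable.add_apply,
      InteriorTensor.tmul_add_left, map_add]
  map_smul' z ξ := Adjointable.ext fun x => by
    simp only [Adjointable.comp_apply, InteriorTensor.creation_apply, Adjointable.smul_apply,
      InteriorTensor.tmul_smul_left, map_smul, RingHom.id_apply]

theorem toRep_apply [CompleteSpace E] [CompleteSpace F]
    (u : CorrespondenceIso (tensorAction φE φF) φG) (ξ : E) (x : F) :
    u.toRep ξ x = u (InteriorTensor.tmul φF ξ x) := rfl

/-- The two axioms are left linearity of u and preservation of ⟪ξ ⊗ w, η ⊗ x⟫ = ⟪w, ⟪ξ, η⟫x⟫, read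
on elementary tensors. -/
theorem isRepresentation_toRep [CompleteSpace E] [CompleteSpace F]
    (u : CorrespondenceIso (tensorAction φE φF) φG) :
    IsRepresentation φE φF φG u.toRep where
  map_left a ξ := Adjointable.ext fun x => by
    rw [Adjointable.comp_apply, toRep_apply, toRep_apply, ← InteriorTensor.mapAdjointable_tmul]
    exact u.map_left a _
  adjoint_comp ξ η := Adjointable.ext fun x => by
    refine HilbertModule.ext_inner (R := Cᵐᵒᵖ) fun w => ?_
    rw [← InteriorTensor.inner_tmul_tmul, ← u.inner_map']
    exact (u.toRep ξ).inner_adj' w _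

/-- Elementary tensors span a dense subspace, and u is continuous and onto. -/
theorem isNondegenerateRep_of_forall_tmul [CompleteSpace E]
    (u : CorrespondenceIso (tensorAction φE φF) φG)
    (h : ∀ ξ x, u (InteriorTensor.tmul φF ξ x) = S ξ x) : IsNondegenerateRep S := by
  intro y
  obtain ⟨x, rfl⟩ := u.surjective y
  change u.toAdjointable.toCLM x ∈ (Submodule.span ℂ
    {y : G | ∃ (ξ : E) (x : F), y = S ξ x}).topologicalClosure
  induction x using InteriorTensor.induction with
  | closed =>
    exact (Submodule.isClosed_topologicalClosure _).preimage u.toAdjointable.toCLM.continuous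
  | zero => rw [map_zero]; exact zero_mem _
  | tmul ξ η =>
    exact Submodule.le_topologicalClosure _ (Submodule.subset_span ⟨ξ, η, h ξ η⟩)
  | add x y hx hy => rw [map_add]; exact add_mem hx hy

end CorrespondenceIso

/-! ### From nondegenerate representations to isomorphisms and covariance -/

namespace IsRepresentation

/-- The linear map `ξ ⊗ x ↦ S(ξ) x`. -/
def preTensorMap (φF : B →⋆ₙₐ[ℂ] Adjointable C F F) (S : E →ₗ[ℂ] Adjointable C F G) :
    PreTensor E φF →ₗ[ℂ] G :=
  TensorProduct.lift (LinearMap.mk₂ ℂ (fun ξ x => S ξ x)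
    (fun ξ₁ ξ₂ x => by simp) (fun z ξ x => by simp) (fun ξ x y => by simp)
    (fun z ξ x => by simp))

theorem inner_preTensorMap (hS : IsRepresentation φE φF φG S) (x y : PreTensor E φF) :
    inner Cᵐᵒᵖ (preTensorMap φF S x) (preTensorMap φF S y) = inner Cᵐᵒᵖ x y := by
  induction x using PreTensor.induction with
  | zero =>
    rw [map_zero, CStarModule.inner_zero_left]
    exact (LinearMap.map_zero₂ (PreTensor.form E φF) y).symm
  | add x₁ x₂ h₁ h₂ =>
    rw [map_add, CStarModule.inner_add_left, PreCStarModule.add_left, h₁, h₂]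
  | tmul ξ z =>
    change inner Cᵐᵒᵖ (preTensorMap φF S (PreTensor.mk φF ξ z)) (preTensorMap φF S y)
      = inner Cᵐᵒᵖ (PreTensor.mk φF ξ z) y
    induction y using PreTensor.induction with
    | zero =>
      rw [map_zero, CStarModule.inner_zero_right]
      exact (map_zero (PreTensor.form E φF (ξ ⊗ₜ z))).symm
    | add y₁ y₂ h₁ h₂ =>
      rw [map_add, CStarModule.inner_add_right, PreCStarModule.inner_add_right, h₁, h₂]
    | tmul η w => exact hS.inner_apply ξ η z w

theorem norm_preTensorMap (hS : IsRepresentation φE φF φG S) (x : PreTensor E φF) :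
    ‖preTensorMap φF S x‖ = ‖x‖ := by
  rw [CStarModule.norm_eq_sqrt_norm_inner_self (A := Cᵐᵒᵖ), hS.inner_preTensorMap]
  rfl

/-- A nondegenerate representation `S` gives an isomorphism `E ⊗_B F ≅ G`,
`ξ ⊗ x ↦ S(ξ) x`. -/
theorem exists_correspondenceIso [CompleteSpace E] [CompleteSpace G]
    (hS : IsRepresentation φE φF φG S) (hn : IsNondegenerateRep S) :
    ∃ u : CorrespondenceIso (tensorAction φE φF) φG,
      ∀ ξ x, u (InteriorTensor.tmul φF ξ x) = S ξ x := by
  let v : InteriorTensor E φF →L[ℂ] G := LinearMap.extendOfNorm (preTensorMap φF S)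
    (Completion.toComplL (𝕜 := ℂ) (E := PreTensor E φF)).toLinearMap
  have hv (a : PreTensor E φF) : v (a : Completion (PreTensor E φF)) = preTensorMap φF S a :=
    LinearMap.extendOfNorm_eq Completion.denseRange_coe
      ⟨1, fun x => by
        rw [one_mul, hS.norm_preTensorMap, ← Completion.norm_coe (x : PreTensor E φF)]; rfl⟩ a
  have hvt (ξ : E) (x : F) : v (InteriorTensor.tmul φF ξ x) = S ξ x := hv _
  have hi (x y : InteriorTensor E φF) : inner Cᵐᵒᵖ (v x) (v y) = inner Cᵐᵒᵖ x y := by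
    refine Completion.induction_on₂ x y (isClosed_eq ?_ CStarModule.continuous_inner) fun a b => ?_
    · exact CStarModule.continuous_inner.comp (by fun_prop : Continuous
        fun p : InteriorTensor E φF × InteriorTensor E φF => (v p.1, v p.2))
    · rw [hv, hv, hS.inner_preTensorMap]
      exact (PreCStarModule.completion_inner_coe _ _).symm
  have hsurj : Function.Surjective v := by
    -- An isometry from a complete space has closed range, and this range contains the span of
    -- S(E)F, which is dense by nondegeneracy.
    refine HilbertModule.surjective_of_inner (C := C) hi (hn.mono ?_)
    change (Submodule.span ℂ {y : G | ∃ (ξ : E) (x : F), y = S ξ x} : Set G)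
      ⊆ (LinearMap.range v.toLinearMap : Set G)
    rw [SetLike.coe_subset_coe, Submodule.span_le]
    rintro _ ⟨ξ, x, rfl⟩
    exact ⟨InteriorTensor.tmul φF ξ x, hvt ξ x⟩
  refine ⟨CorrespondenceIso.ofSurjective v hi hsurj fun a x => ?_, hvt⟩
  change (v.comp (tensorAction φE φF a).toCLM) x = ((φG a).toCLM.comp v) x
  congr 1
  refine InteriorTensor.eqOn_tmul fun ξ y => ?_
  have h1 : (tensorAction φE φF a).toCLM (InteriorTensor.tmul φF ξ y)
      = InteriorTensor.tmul φF (φE a ξ) y := InteriorTensor.mapAdjointable_tmul φF _ ξ y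
  rw [ContinuousLinearMap.comp_apply, ContinuousLinearMap.comp_apply, h1, hvt, hvt, hS.map_left]
  rfl

/-- For a nondegenerate representation `S`, the algebra `𝔹(E)` acts on `G` by
`T · S(ξ) x = S(T ξ) x`. -/
theorem exists_adjointable_hom [CompleteSpace E] [CompleteSpace G]
    (hS : IsRepresentation φE φF φG S) (hn : IsNondegenerateRep S) :
    ∃ θ : Adjointable B E E →⋆ₙₐ[ℂ] Adjointable C G G,
      ∀ T ξ x, θ T (S ξ x) = S (T ξ) x := by
  obtain ⟨u, hu⟩ := hS.exists_correspondenceIso hn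
  refine ⟨u.conjHom.comp (InteriorTensor.mapHom φF), fun T ξ x => ?_⟩
  rw [← hu, ← hu, ← InteriorTensor.mapAdjointable_tmul]
  exact u.conjHom_apply _ _

/-- The required ϑ is the restriction to 𝕂(E) of the action θ of all of 𝔹(E). Both identities are
verified on the dense span of S(E)F; θ(φE(a)) = φG(a) even holds for every a, compact or not. -/
theorem isCuntzPimsnerCovariant [CompleteSpace E] [CompleteSpace G]
    (hS : IsRepresentation φE φF φG S) (hn : IsNondegenerateRep S) :
    IsCuntzPimsnerCovariant φE φG S := by
  obtain ⟨θ, hθ⟩ := hS.exists_adjointable_hom hn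
  refine ⟨θ.comp (NonUnitalStarSubalgebraClass.subtype (compactOperators B E)),
    fun ξ η => Adjointable.eq_of_eqOn_span hn ?_, fun a h => Adjointable.eq_of_eqOn_span hn ?_⟩
  · rintro _ ⟨ζ, x, rfl⟩
    exact (hθ _ ζ x).trans (hS.comp_adjoint_apply ξ η ζ x).symm
  · rintro _ ⟨ζ, x, rfl⟩
    refine (hθ _ ζ x).trans ?_
    change S (φE a ζ) x = _
    rw [hS.map_left]
    rfl

end IsRepresentation

/-! ### Compact operators: covariance implies nondegeneracy for proper E -/

instance [CompleteSpace E] : IsClosed (compactOperators B E : Set (Adjointable B E E)) :=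
  (finiteRankOperators B E).isClosed_topologicalClosure

theorem compactOperators_induction [CompleteSpace E] {p : compactOperators B E → Prop}
    (closed : IsClosed {T | p T}) (zero : p 0)
    (rankOne : ∀ ξ η, p ⟨rankOne ξ η, rankOne_mem ξ η⟩)
    (add : ∀ S T, p S → p T → p (S + T)) (smul : ∀ (z : ℂ) T, p T → p (z • T))
    (T : compactOperators B E) : p T := by
  have hmem : ∀ T ∈ finiteRankOperators B E, ∃ h : T ∈ compactOperators B E, p ⟨T, h⟩ := by
    intro T hT
    change T ∈ Submodule.span ℂ _ at hT
    induction hT using Submodule.span_induction with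
    | mem T h => obtain ⟨⟨ξ, η⟩, rfl⟩ := h; exact ⟨_, rankOne ξ η⟩
    | zero => exact ⟨zero_mem _, zero⟩
    | add S T _ _ h1 h2 =>
      obtain ⟨h1, h1'⟩ := h1
      obtain ⟨h2, h2'⟩ := h2
      exact ⟨add_mem h1 h2, add _ _ h1' h2'⟩
    | smul z T _ h =>
      obtain ⟨h, h'⟩ := h
      exact ⟨SMulMemClass.smul_mem z h, smul z _ h'⟩
  obtain ⟨T, hT⟩ := T
  refine (closed.closure_subset_iff.mpr (Set.Subset.refl _)) ?_
  rw [closure_subtype]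
  refine closure_mono ?_ hT
  intro S hS
  obtain ⟨h, hp⟩ := hmem S hS
  exact ⟨⟨S, h⟩, hp, rfl⟩

/-- Properness makes φG(a)x = ϑ(φE(a))x available for every a, and this lies in the closed span of
the vectors S(ξ)S(η)⋆x. Since φG(A)G spans a dense subspace, so does S(E)F. -/
theorem IsCuntzPimsnerCovariant.isNondegenerateRep [CompleteSpace E] [CompleteSpace G]
    (hφG : IsNondegenerateAction φG) (hE : IsProper φE)
    (hS : IsCuntzPimsnerCovariant φE φG S) : IsNondegenerateRep S := by
  obtain ⟨ϑ, hϑ, hϑ'⟩ := hS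
  refine dense_span_of_subset_closure hφG ?_
  rintro _ ⟨a, x, rfl⟩
  rw [← hϑ' a (hE a)]
  refine compactOperators_induction (p := fun T => ϑ T x ∈ (Submodule.span ℂ
    {y : G | ∃ (ξ : E) (x : F), y = S ξ x}).topologicalClosure) ?_ ?_ ?_ ?_ ?_ ⟨φE a, hE a⟩
  · refine (Submodule.isClosed_topologicalClosure _).preimage ?_
    -- Continuity of ϑ is automatic, because 𝕂(E) is closed and hence a C⋆-algebra.
    exact (Adjointable.applyCLM x).continuous.comp (map_continuous ϑ)
  · rw [map_zero]; exact zero_mem _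
  · intro ξ η
    rw [hϑ]
    exact Submodule.le_topologicalClosure _ (Submodule.subset_span ⟨ξ, _, rfl⟩)
  · intro S T hS hT
    rw [map_add]
    exact add_mem hS hT
  · intro z T hT
    rw [map_smul]
    exact Submodule.smul_mem _ z hT

end Tensor

/-! ### Injective ⋆-homomorphisms: closed range and lifting -/

section Hom
variable {O D K : Type*} [NonUnitalCStarAlgebra O] [NonUnitalCStarAlgebra D]

theorem NonUnitalStarAlgHom.isClosed_range_of_injective (i : O →⋆ₙₐ[ℂ] D)
    (hi : Function.Injective i) : IsClosed (Set.range i) :=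
  (NonUnitalStarAlgHom.isometry i hi).isClosedEmbedding.isClosed_range

theorem NonUnitalStarAlgHom.exists_lift_of_injective [NonUnitalNonAssocSemiring K] [Module ℂ K]
    [Star K] (i : O →⋆ₙₐ[ℂ] D) (hi : Function.Injective i) (f : K →⋆ₙₐ[ℂ] D)
    (h : ∀ k, f k ∈ Set.range i) : ∃ g : K →⋆ₙₐ[ℂ] O, ∀ k, i (g k) = f k := by
  choose g hg using h
  exact ⟨{ toFun := g
           map_smul' := fun z k => hi (by simp [hg])
           map_zero' := hi (by simp [hg])
           map_add' := fun j k => hi (by simp [hg])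
           map_mul' := fun j k => hi (by simp [hg])
           map_star' := fun k => hi (by simp [hg, map_star]) }, hg⟩

end Hom

/-! ### A C⋆-algebra inside its multipliers -/

section leftMul
variable {O : Type*} [NonUnitalCStarAlgebra O] [PartialOrder O] [StarOrderedRing O]

@[simp] theorem leftMul_apply (x y : O) : leftMul O x y = x * y := rfl

theorem leftMul_injective : Function.Injective (leftMul O) := by
  rw [injective_iff_map_eq_zero]
  intro x hx
  have h := congrArg (fun T : Adjointable O O O => T (star x)) hx
  exact (CStarRing.mul_star_self_eq_zero_iff x).mp h

/-- The image of `O` is an ideal in `𝔹(O)`. -/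
theorem leftMul_comp (x : O) (T : Adjointable O O O) :
    (leftMul O x).comp T = leftMul O (star (T.adj (star x))) := by
  ext y
  -- In the Hilbert module O the product x · T(y) is the inner product of x⋆ with T(y), so T can be
  -- moved to the other side.
  have h := congrArg MulOpposite.unop (T.inner_adj y (star x))
  change star (T.adj (star x)) * y = star (star x) * T y at h
  rw [star_star] at h
  exact h.symm

theorem isNondegenerateAction_leftMul : IsNondegenerateAction (leftMul O) := by
  intro x
  exact mem_closure_of_tendsto
    ((CStarAlgebra.increasingApproximateUnit O).tendsto_mul_right x)
    (Eventually.of_forall fun r => Submodule.subset_span ⟨r, x, rfl⟩)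

end leftMul

/-! ### The C⋆-subalgebra generated by a representation -/

section Generated
variable {A E D : Type*} [NonUnitalCStarAlgebra A] [AddCommGroup E] [Module ℂ E]
  [NonUnitalCStarAlgebra D]

/-- The C⋆-subalgebra generated by the images of `φ` and `S`. -/
def generatedAlgebra (φ : A →⋆ₙₐ[ℂ] D) (S : E →ₗ[ℂ] D) : NonUnitalStarSubalgebra ℂ D :=
  (NonUnitalStarAlgebra.adjoin ℂ (Set.range φ ∪ Set.range S)).topologicalClosure

variable (φ : A →⋆ₙₐ[ℂ] D) (S : E →ₗ[ℂ] D)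

instance : IsClosed (generatedAlgebra φ S : Set D) :=
  NonUnitalStarSubalgebra.isClosed_topologicalClosure _

theorem apply_mem_generatedAlgebra (a : A) : φ a ∈ generatedAlgebra φ S :=
  subset_closure (NonUnitalStarAlgebra.subset_adjoin ℂ _ (Or.inl ⟨a, rfl⟩))

theorem apply_mem_generatedAlgebra' (ξ : E) : S ξ ∈ generatedAlgebra φ S :=
  subset_closure (NonUnitalStarAlgebra.subset_adjoin ℂ _ (Or.inr ⟨ξ, rfl⟩))

variable {φ S}

theorem generatedAlgebra_le {T : NonUnitalStarSubalgebra ℂ D} (hT : IsClosed (T : Set D))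
    (hφ : ∀ a, φ a ∈ T) (hS : ∀ ξ, S ξ ∈ T) : generatedAlgebra φ S ≤ T := by
  refine NonUnitalStarSubalgebra.topologicalClosure_minimal _
    (NonUnitalStarAlgebra.adjoin_le ?_) hT
  rintro _ (⟨a, rfl⟩ | ⟨ξ, rfl⟩)
  · exact hφ a
  · exact hS ξ

theorem hom_ext_of_generatedAlgebra_eq_top {D' : Type*} [NonUnitalCStarAlgebra D']
    (h : generatedAlgebra φ S = ⊤) {ψ₁ ψ₂ : D →⋆ₙₐ[ℂ] D'} (hφ : ∀ a, ψ₁ (φ a) = ψ₂ (φ a))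
    (hS : ∀ ξ, ψ₁ (S ξ) = ψ₂ (S ξ)) : ψ₁ = ψ₂ := by
  have h1 : generatedAlgebra φ S ≤ NonUnitalStarAlgHom.equalizer ψ₁ ψ₂ :=
    generatedAlgebra_le (isClosed_eq (map_continuous ψ₁) (map_continuous ψ₂)) hφ hS
  rw [h] at h1
  exact NonUnitalStarAlgHom.ext fun x => h1 (NonUnitalStarAlgebra.mem_top (x := x))

theorem map_mem_of_generatedAlgebra_eq_top {D' : Type*} [NonUnitalCStarAlgebra D']
    (h : generatedAlgebra φ S = ⊤) {ψ : D →⋆ₙₐ[ℂ] D'} {T : NonUnitalStarSubalgebra ℂ D'}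
    (hT : IsClosed (T : Set D')) (hφ : ∀ a, ψ (φ a) ∈ T) (hS : ∀ ξ, ψ (S ξ) ∈ T) (x : D) :
    ψ x ∈ T := by
  have h1 : generatedAlgebra φ S ≤ T.comap ψ :=
    generatedAlgebra_le (hT.preimage (map_continuous ψ)) hφ hS
  rw [h] at h1
  exact h1 (NonUnitalStarAlgebra.mem_top (x := x))

variable (φ S)

/-- Restriction of the codomain of `φ` to a C⋆-subalgebra. -/
def codRestrictHom (T : NonUnitalStarSubalgebra ℂ D) [IsClosed (T : Set D)]
    (h : ∀ a, φ a ∈ T) : A →⋆ₙₐ[ℂ] T where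
  toFun a := ⟨φ a, h a⟩
  map_smul' z a := Subtype.ext (map_smul φ z a)
  map_zero' := Subtype.ext (map_zero φ)
  map_add' a b := Subtype.ext (map_add φ a b)
  map_mul' a b := Subtype.ext (map_mul φ a b)
  map_star' a := Subtype.ext (map_star φ a)

/-- Restriction of the codomain of `S` to a C⋆-subalgebra. -/
def codRestrictLinear (T : NonUnitalStarSubalgebra ℂ D) [IsClosed (T : Set D)]
    (h : ∀ ξ, S ξ ∈ T) : E →ₗ[ℂ] T where
  toFun ξ := ⟨S ξ, h ξ⟩
  map_add' ξ η := Subtype.ext (map_add S ξ η)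
  map_smul' z ξ := Subtype.ext (map_smul S z ξ)

/-- The inclusion of a C⋆-subalgebra. -/
def inclusionHom (T : NonUnitalStarSubalgebra ℂ D) [IsClosed (T : Set D)] : T →⋆ₙₐ[ℂ] D where
  toFun x := x
  map_smul' _ _ := rfl
  map_zero' := rfl
  map_add' _ _ := rfl
  map_mul' _ _ := rfl
  map_star' _ := rfl

/-- The closure is now taken inside T. As T is closed in D, the image in D of the new subalgebra is
closed and contains the generators, hence contains T. This allows any representation to be replaced
by a generating one. -/
theorem generatedAlgebra_codRestrict :
    generatedAlgebra
      (codRestrictHom φ (generatedAlgebra φ S) (apply_mem_generatedAlgebra φ S))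
      (codRestrictLinear S (generatedAlgebra φ S) (apply_mem_generatedAlgebra' φ S)) = ⊤ := by
  set T := generatedAlgebra φ S with hT
  set φ' := codRestrictHom φ T (apply_mem_generatedAlgebra φ S)
  set S' := codRestrictLinear S T (apply_mem_generatedAlgebra' φ S)
  have hcl : IsClosed ((generatedAlgebra φ' S').map (inclusionHom T) : Set D) := by
    have h1 : IsClosed (T : Set D) := inferInstance
    exact h1.isClosedEmbedding_subtypeVal.isClosedMap _
      (inferInstance : IsClosed (generatedAlgebra φ' S' : Set T))
  have h : T ≤ (generatedAlgebra φ' S').map (inclusionHom T) :=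
    generatedAlgebra_le hcl (fun a => ⟨φ' a, apply_mem_generatedAlgebra φ' S' a, rfl⟩)
      (fun ξ => ⟨S' ξ, apply_mem_generatedAlgebra' φ' S' ξ, rfl⟩)
  rw [eq_top_iff]
  rintro ⟨x, hx⟩ -
  obtain ⟨y, hy, hyx⟩ := h hx
  have : y = ⟨x, hx⟩ := Subtype.ext hyx
  exact this ▸ hy

end Generated

/-! ### Covariant representations in C⋆-algebras -/

section Covariant
variable {A E D : Type u} [NonUnitalCStarAlgebra A] [PartialOrder A] [StarOrderedRing A]
  [NormedAddCommGroup E] [NormedSpace ℂ E] [CompleteSpace E] [SMul Aᵐᵒᵖ E] [CStarModule Aᵐᵒᵖ E]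
  [NonUnitalCStarAlgebra D] {φE : A →⋆ₙₐ[ℂ] Adjointable A E E}
  {φ : A →⋆ₙₐ[ℂ] D} {S : E →ₗ[ℂ] D}

namespace IsCovariantRepIn

theorem comp {D' : Type u} [NonUnitalCStarAlgebra D'] (h : IsCovariantRepIn φE φ S)
    (ψ : D →⋆ₙₐ[ℂ] D') : IsCovariantRepIn φE (ψ.comp φ) (compRep ψ S) where
  map_left a ξ := by
    change ψ _ = ψ (φ a) * ψ _
    rw [h.map_left, map_mul]
  star_mul ξ η := by
    change star (ψ _) * ψ _ = ψ (φ _)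
    rw [← map_star, ← map_mul, h.star_mul]
  covariant := by
    obtain ⟨ϑ, h1, h2⟩ := h.covariant
    refine ⟨ψ.comp ϑ, fun ξ η => ?_, fun a ha => ?_⟩
    · change ψ (ϑ _) = ψ _ * star (ψ _)
      rw [h1, map_mul, map_star]
    · exact congrArg ψ (h2 a ha)

/-- Only ϑ needs an argument: it maps rank-one operators into i(D), and i(D) is closed, so it maps
all of 𝕂(E) there and lifts. Applied to inclusions of subalgebras and to O → 𝔹(O). -/
theorem of_comp_injective {D' : Type u} [NonUnitalCStarAlgebra D'] {i : D →⋆ₙₐ[ℂ] D'}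
    (hi : Function.Injective i) (h : IsCovariantRepIn φE (i.comp φ) (compRep i S)) :
    IsCovariantRepIn φE φ S where
  map_left a ξ := hi (by rw [map_mul]; exact h.map_left a ξ)
  star_mul ξ η := hi (by rw [map_mul, map_star]; exact h.star_mul ξ η)
  covariant := by
    obtain ⟨ϑ, h1, h2⟩ := h.covariant
    have hr : ∀ T, ϑ T ∈ NonUnitalStarAlgHom.range i := by
      refine compactOperators_induction ?_ ?_ ?_ ?_ ?_
      · exact (i.isClosed_range_of_injective hi).preimage (map_continuous ϑ)
      · rw [map_zero]; exact zero_mem _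
      · intro ξ η
        rw [h1]
        exact ⟨S ξ * star (S η), (map_mul i _ _).trans (congrArg _ (map_star i _))⟩
      · intro T U hT hU
        rw [map_add]
        exact add_mem hT hU
      · intro z T hT
        rw [map_smul]
        exact SMulMemClass.smul_mem z hT
    obtain ⟨ϑ', hϑ'⟩ := i.exists_lift_of_injective hi ϑ hr
    refine ⟨ϑ', fun ξ η => hi ?_, fun a ha => hi ?_⟩
    · rw [hϑ', h1, map_mul, map_star]
      rfl
    · rw [hϑ', h2]
      rfl

/-- ‖S(ξ)‖² = ‖φ(⟪ξ, ξ⟫)‖ and φ is contractive. The bound does not depend on the representation, so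
that products of representations exist. -/
theorem norm_apply_le (h : IsCovariantRepIn φE φ S) (ξ : E) : ‖S ξ‖ ≤ ‖ξ‖ := by
  refine le_of_sq_le_sq ?_ (norm_nonneg _)
  rw [sq, ← CStarRing.norm_star_mul_self, h.star_mul, ← norm_rinner_self (B := A)]
  exact NonUnitalStarAlgHom.norm_apply_le φ _

theorem continuous (h : IsCovariantRepIn φE φ S) : Continuous S :=
  AddMonoidHomClass.continuous_of_bound S 1 fun ξ => by rw [one_mul]; exact h.norm_apply_le ξ

/-- The difference d of the two sides satisfies S(η)⋆d = 0 for all η, and d⋆ is a combination of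
terms ending in some S(η)⋆; hence d⋆d = 0. -/
theorem map_op_smul (h : IsCovariantRepIn φE φ S) (ξ : E) (a : A) :
    S (MulOpposite.op a • ξ) = S ξ * φ a := by
  rw [← sub_eq_zero, ← CStarRing.star_mul_self_eq_zero_iff]
  have h1 (η : E) : star (S η) * (S ξ * φ a) = star (S η) * S (MulOpposite.op a • ξ) := by
    rw [← mul_assoc, h.star_mul, h.star_mul, rinner_op_smul_right, map_mul]
  rw [mul_sub, star_sub, StarMul.star_mul, sub_mul, sub_mul, h1, mul_assoc (star (φ a)),
    mul_assoc (star (φ a)), h1, sub_self]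

/-- The closed span N of φ(A)D is a right ideal. It contains φ(A) by an approximate unit, S(E)
because AE is dense in E, and S(E)⋆ because EA is dense in E. A closed right ideal containing the
generators and their adjoints is all of D. -/
theorem isNondegenerateAction [PartialOrder D] [StarOrderedRing D] (h : IsCovariantRepIn φE φ S)
    (hE : IsNondegenerateAction φE) (hg : generatedAlgebra φ S = ⊤) :
    IsNondegenerateAction ((leftMul D).comp φ) := by
  let N : Submodule ℂ D := (Submodule.span ℂ
    {y : D | ∃ (a : A) (x : D), y = ((leftMul D).comp φ) a x}).topologicalClosure
  have hN : IsClosed (N : Set D) := Submodule.isClosed_topologicalClosure _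
  have hmul (a : A) (x : D) : φ a * x ∈ N :=
    Submodule.le_topologicalClosure _ (Submodule.subset_span ⟨a, x, rfl⟩)
  have hideal : ∀ x ∈ N, ∀ y, x * y ∈ N := by
    intro x hx y
    have hle : N ≤ N.comap (LinearMap.mulRight ℂ y) := by
      refine Submodule.topologicalClosure_minimal _ (Submodule.span_le.mpr ?_)
        (hN.preimage (continuous_mul_const y))
      rintro _ ⟨a, x, rfl⟩
      change φ a * x * y ∈ N
      rw [mul_assoc]
      exact hmul a _
    exact hle hx
  have hφ (a : A) : φ a ∈ N := by
    refine hN.mem_of_tendsto ((map_continuous φ).tendsto a |>.comp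
      ((CStarAlgebra.increasingApproximateUnit A).tendsto_mul_right a))
      (Eventually.of_forall fun b => ?_)
    change φ (b * a) ∈ N
    rw [map_mul]
    exact hmul b _
  have hS (ξ : E) : S ξ ∈ N := by
    have hle : (Submodule.span ℂ {y : E | ∃ (a : A) (x : E), y = φE a x}).topologicalClosure
        ≤ N.comap S := by
      refine Submodule.topologicalClosure_minimal _ (Submodule.span_le.mpr ?_)
        (hN.preimage h.continuous)
      rintro _ ⟨a, x, rfl⟩
      change S _ ∈ N
      rw [h.map_left]
      exact hmul a _
    exact hle (hE ξ)
  have hS' (ξ : E) : star (S ξ) ∈ N := by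
    refine hN.mem_of_tendsto ((h.continuous.star.tendsto ξ).comp
      (HilbertModule.tendsto_approximateUnit_smul (R := Aᵐᵒᵖ) ξ))
      (Eventually.of_forall fun b => ?_)
    change star (S (b • ξ)) ∈ N
    rw [← MulOpposite.op_unop b, h.map_op_smul, StarMul.star_mul, ← map_star]
    exact hmul _ _
  -- N is not known to be closed under ⋆, so membership of x and of x⋆ is carried through the
  -- induction together.
  have hadj : ∀ x ∈ NonUnitalStarAlgebra.adjoin ℂ (Set.range φ ∪ Set.range S),
      x ∈ N ∧ star x ∈ N := by
    intro x hx
    induction hx using NonUnitalStarAlgebra.adjoin_induction with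
    | mem x hx =>
      rcases hx with ⟨a, rfl⟩ | ⟨ξ, rfl⟩
      · exact ⟨hφ a, by rw [← map_star]; exact hφ _⟩
      · exact ⟨hS ξ, hS' ξ⟩
    | zero => rw [star_zero]; exact ⟨zero_mem _, zero_mem _⟩
    | add x y _ _ hx hy => rw [star_add]; exact ⟨add_mem hx.1 hy.1, add_mem hx.2 hy.2⟩
    | mul x y _ _ hx hy =>
      rw [StarMul.star_mul]; exact ⟨hideal _ hx.1 _, hideal _ hy.2 _⟩
    | smul z x _ hx =>
      rw [star_smul]; exact ⟨N.smul_mem _ hx.1, N.smul_mem _ hx.2⟩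
    | star x _ hx => rw [star_star]; exact ⟨hx.2, hx.1⟩
  intro x
  have hx : x ∈ generatedAlgebra φ S := hg ▸ NonUnitalStarAlgebra.mem_top
  exact (closure_minimal (fun y hy => (hadj y hy).1) hN : _ ⊆ (N : Set D)) hx

section Adjointable
variable {B F : Type u} [NonUnitalCStarAlgebra B] [PartialOrder B] [StarOrderedRing B]
  [NormedAddCommGroup F] [NormedSpace ℂ F] [CompleteSpace F] [SMul Bᵐᵒᵖ F] [CStarModule Bᵐᵒᵖ F]
  {φ : A →⋆ₙₐ[ℂ] Adjointable B F F} {S : E →ₗ[ℂ] Adjointable B F F}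

theorem isRepresentation (h : IsCovariantRepIn φE φ S) : IsRepresentation φE φ φ S :=
  ⟨h.map_left, h.star_mul⟩

theorem isNondegenerateRep (h : IsCovariantRepIn φE φ S) (hE : IsProper φE)
    (hφ : IsNondegenerateAction φ) : IsNondegenerateRep S :=
  IsCuntzPimsnerCovariant.isNondegenerateRep hφ hE h.covariant

end Adjointable
end IsCovariantRepIn

theorem IsRepresentation.isCovariantRepIn {B F : Type u} [NonUnitalCStarAlgebra B]
    [PartialOrder B] [StarOrderedRing B] [NormedAddCommGroup F] [NormedSpace ℂ F]
    [CompleteSpace F] [SMul Bᵐᵒᵖ F] [CStarModule Bᵐᵒᵖ F]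
    {φ : A →⋆ₙₐ[ℂ] Adjointable B F F} {S : E →ₗ[ℂ] Adjointable B F F}
    (h : IsRepresentation φE φ φ S) (hn : IsNondegenerateRep S) : IsCovariantRepIn φE φ S :=
  ⟨h.map_left, h.adjoint_comp, h.isCuntzPimsnerCovariant hn⟩

end Covariant

/-! ### Seminorms on the free algebra -/

section FreeAlgebra
variable {A E D : Type*} [NonUnitalCStarAlgebra A] [AddCommGroup E] [Module ℂ E]
  [NonUnitalCStarAlgebra D]

/-- The free algebra on symbols for the elements of `A`, the elements of `E` and the adjoints of
the elements of `E`. -/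
abbrev FreeRepAlgebra (A E : Type*) : Type _ := MonoidAlgebra ℂ (FreeSemigroup (A ⊕ E ⊕ E))

/-- The homomorphism from the free algebra defined by `(φ, S)`. -/
def freeHom (φ : A →⋆ₙₐ[ℂ] D) (S : E →ₗ[ℂ] D) : FreeRepAlgebra A E →ₙₐ[ℂ] D :=
  MonoidAlgebra.liftMagma ℂ (FreeSemigroup.lift
    (Sum.elim φ (Sum.elim S fun ξ => star (S ξ))))

variable (φ : A →⋆ₙₐ[ℂ] D) (S : E →ₗ[ℂ] D)

/-- The generators of the free algebra. -/
def freeGen (x : A ⊕ E ⊕ E) : FreeRepAlgebra A E :=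
  MonoidAlgebra.single (FreeSemigroup.of x) 1

@[simp] theorem freeHom_freeGen (x : A ⊕ E ⊕ E) :
    freeHom φ S (freeGen x) = Sum.elim φ (Sum.elim S fun ξ => star (S ξ)) x := by
  simp [freeHom, freeGen]

theorem compRep_freeHom {D' : Type*} [NonUnitalCStarAlgebra D'] (ψ : D →⋆ₙₐ[ℂ] D')
    (x : FreeRepAlgebra A E) : freeHom (ψ.comp φ) (compRep ψ S) x = ψ (freeHom φ S x) := by
  have h : freeHom (ψ.comp φ) (compRep ψ S)
      = (ψ : D →ₙₐ[ℂ] D').comp (freeHom φ S) := by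
    refine (MonoidAlgebra.liftMagma ℂ).symm.injective (FreeSemigroup.lift.symm.injective ?_)
    funext x
    change freeHom (ψ.comp φ) (compRep ψ S) (freeGen x) = ψ (freeHom φ S (freeGen x))
    rw [freeHom_freeGen, freeHom_freeGen]
    rcases x with a | ξ | ξ
    · rfl
    · rfl
    · exact (map_star ψ _).symm
  rw [h]
  rfl

/-- No involution on the free algebra is needed: φ(a)⋆ = φ(a⋆) is already a generator, and each
S(ξ)⋆ has a symbol of its own. Thus the range of a merely multiplicative map contains the ⋆-algebra
generated. -/
theorem generatedAlgebra_subset_closure_range_freeHom :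
    (generatedAlgebra φ S : Set D) ⊆ closure (Set.range (freeHom φ S)) := by
  refine closure_mono ?_
  have h : NonUnitalAlgebra.adjoin ℂ ((Set.range φ ∪ Set.range S) ∪ star (Set.range φ ∪ Set.range S))
      ≤ NonUnitalAlgHom.range (freeHom φ S) := by
    refine NonUnitalAlgebra.adjoin_le ?_
    rintro x (hx | hx)
    · rcases hx with ⟨a, rfl⟩ | ⟨ξ, rfl⟩
      · exact ⟨freeGen (.inl a), freeHom_freeGen φ S _⟩
      · exact ⟨freeGen (.inr (.inl ξ)), freeHom_freeGen φ S _⟩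
    · rcases hx with ⟨a, ha⟩ | ⟨ξ, hξ⟩
      · refine ⟨freeGen (.inl (star a)), (freeHom_freeGen φ S _).trans ?_⟩
        rw [Sum.elim_inl, map_star, ha, star_star]
      · refine ⟨freeGen (.inr (.inr ξ)), (freeHom_freeGen φ S _).trans ?_⟩
        rw [Sum.elim_inr, Sum.elim_inr, hξ, star_star]
  exact h

/-- If the seminorm of `(φ', S')` on the free algebra is dominated by that of `(φ, S)`, then
`(φ', S')` factors through the C⋆-algebra generated by `(φ, S)`. -/
theorem exists_hom_of_norm_freeHom_le {D' : Type*} [NonUnitalCStarAlgebra D']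
    (hg : generatedAlgebra φ S = ⊤) (φ' : A →⋆ₙₐ[ℂ] D') (S' : E →ₗ[ℂ] D')
    (h : ∀ x, ‖freeHom φ' S' x‖ ≤ ‖freeHom φ S x‖) :
    ∃ ψ : D →⋆ₙₐ[ℂ] D', (∀ a, ψ (φ a) = φ' a) ∧ ∀ ξ, ψ (S ξ) = S' ξ := by
  have hd : DenseRange (freeHom φ S) := fun x =>
    generatedAlgebra_subset_closure_range_freeHom φ S (hg ▸ NonUnitalStarAlgebra.mem_top)
  let f : FreeRepAlgebra A E →ₗ[ℂ] D' := (freeHom φ' S' : FreeRepAlgebra A E →ₗ[ℂ] D')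
  let e : FreeRepAlgebra A E →ₗ[ℂ] D := (freeHom φ S : FreeRepAlgebra A E →ₗ[ℂ] D)
  let ψ : D →L[ℂ] D' := f.extendOfNorm e
  have hψ (x : FreeRepAlgebra A E) : ψ (freeHom φ S x) = freeHom φ' S' x :=
    LinearMap.extendOfNorm_eq (f := f) (e := e) hd ⟨1, fun x => by rw [one_mul]; exact h x⟩ x
  have hmul (x y : D) : ψ (x * y) = ψ x * ψ y := by
    refine hd.induction_on₂ (p := fun x y => ψ (x * y) = ψ x * ψ y)
      (isClosed_eq (by fun_prop) (by fun_prop)) (fun x y => ?_) x y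
    rw [← map_mul, hψ, hψ, hψ, map_mul]
  have hφ (a : A) : ψ (φ a) = φ' a := by
    have := hψ (freeGen (.inl a))
    rwa [freeHom_freeGen, freeHom_freeGen] at this
  have hS (ξ : E) : ψ (S ξ) = S' ξ := by
    have := hψ (freeGen (.inr (.inl ξ)))
    rwa [freeHom_freeGen, freeHom_freeGen] at this
  -- The separate symbols for adjoints force compatibility with ⋆ on generators; it then passes to
  -- products, sums and limits.
  have hS' (ξ : E) : ψ (star (S ξ)) = star (S' ξ) := by
    have := hψ (freeGen (.inr (.inr ξ)))
    rwa [freeHom_freeGen, freeHom_freeGen] at this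
  have hstar' : ∀ x ∈ NonUnitalStarAlgebra.adjoin ℂ (Set.range φ ∪ Set.range S),
      ψ (star x) = star (ψ x) := by
    intro x hx
    induction hx using NonUnitalStarAlgebra.adjoin_induction with
    | mem x hx =>
      rcases hx with ⟨a, rfl⟩ | ⟨ξ, rfl⟩
      · rw [← map_star, hφ, hφ, map_star]
      · rw [hS', hS]
    | zero => rw [star_zero, map_zero, star_zero]
    | add x y _ _ hx hy => rw [star_add, map_add, hx, hy, map_add, star_add]
    | mul x y _ _ hx hy => rw [star_mul, hmul, hx, hy, hmul, star_mul]
    | smul z x _ hx => rw [star_smul, map_smul, hx, map_smul, star_smul]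
    | star x _ hx => rw [hx, star_star, star_star]
  have hstar (x : D) : ψ (star x) = star (ψ x) := by
    have hx : x ∈ generatedAlgebra φ S := hg ▸ NonUnitalStarAlgebra.mem_top
    exact closure_minimal (t := {x | ψ (star x) = star (ψ x)}) hstar'
      (isClosed_eq (by fun_prop) (by fun_prop)) hx
  exact ⟨{ toFun := ψ
           map_smul' := map_smul ψ
           map_zero' := map_zero ψ
           map_add' := map_add ψ
           map_mul' := hmul
           map_star' := hstar }, hφ, hS⟩

end FreeAlgebra

/-! ### Bounded products -/

section Product
variable {K : Type*} [NonUnitalCStarAlgebra K] {ι : Type*} {D : ι → Type*}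
  [∀ i, NonUnitalCStarAlgebra (D i)]

/-- The product of bounded linear maps of norm at most one. -/
def lpPiLinear {E : Type*} [NormedAddCommGroup E] [NormedSpace ℂ E] (S : ∀ i, E →ₗ[ℂ] D i)
    (h : ∀ i ξ, ‖S i ξ‖ ≤ ‖ξ‖) : E →ₗ[ℂ] lp D ∞ where
  toFun ξ := ⟨fun i => S i ξ, memℓp_infty ⟨‖ξ‖, by rintro _ ⟨i, rfl⟩; exact h i ξ⟩⟩
  map_add' ξ η := Subtype.ext (funext fun i => map_add (S i) ξ η)
  map_smul' z ξ := Subtype.ext (funext fun i => map_smul (S i) z ξ)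

/-- The product of ⋆-homomorphisms. -/
def lpPi (φ : ∀ i, K →⋆ₙₐ[ℂ] D i) : K →⋆ₙₐ[ℂ] lp D ∞ where
  toFun k := ⟨fun i => φ i k, memℓp_infty ⟨‖k‖, by
    rintro _ ⟨i, rfl⟩; exact NonUnitalStarAlgHom.norm_apply_le (φ i) k⟩⟩
  map_smul' z k := Subtype.ext (funext fun i => map_smul (φ i) z k)
  map_zero' := Subtype.ext (funext fun i => map_zero (φ i))
  map_add' j k := Subtype.ext (funext fun i => map_add (φ i) j k)
  map_mul' j k := Subtype.ext (funext fun i => map_mul (φ i) j k)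
  map_star' k := Subtype.ext (funext fun i => map_star (φ i) k)

/-- The projection to a factor. -/
def lpProj (i : ι) : lp D ∞ →⋆ₙₐ[ℂ] D i where
  toFun x := x i
  map_smul' _ _ := rfl
  map_zero' := rfl
  map_add' _ _ := rfl
  map_mul' _ _ := rfl
  map_star' _ := rfl

end Product

/-! ### Existence of the Cuntz–Pimsner algebra -/

section Existence
variable {A E : Type u} [NonUnitalCStarAlgebra A] [PartialOrder A] [StarOrderedRing A]
  [NormedAddCommGroup E] [NormedSpace ℂ E] [CompleteSpace E] [SMul Aᵐᵒᵖ E] [CStarModule Aᵐᵒᵖ E]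
  (φE : A →⋆ₙₐ[ℂ] Adjointable A E E)

/-- A covariant representation in some C⋆-algebra. -/
structure CovariantRep : Type (u + 1) where
  D : Type u
  [inst : NonUnitalCStarAlgebra D]
  φ : A →⋆ₙₐ[ℂ] D
  S : E →ₗ[ℂ] D
  isRep : IsCovariantRepIn φE φ S

attribute [instance] CovariantRep.inst

variable {φE}

/-- The seminorm on the free algebra defined by a covariant representation. -/
def CovariantRep.seminorm (ρ : CovariantRep φE) (x : FreeRepAlgebra A E) : ℝ :=
  ‖freeHom ρ.φ ρ.S x‖

/-- All relations hold coordinatewise, with the product of the ϑ's as the new ϑ. An index type in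
`Type u` keeps the product in the same universe. -/
theorem isCovariantRepIn_lpPi {ι : Type u} (ρ : ι → CovariantRep φE) :
    IsCovariantRepIn φE (lpPi fun i => (ρ i).φ)
      (lpPiLinear (fun i => (ρ i).S) fun i => (ρ i).isRep.norm_apply_le) where
  map_left a ξ := Subtype.ext (funext fun i => (ρ i).isRep.map_left a ξ)
  star_mul ξ η := Subtype.ext (funext fun i => (ρ i).isRep.star_mul ξ η)
  covariant := by
    choose ϑ h1 h2 using fun i => (ρ i).isRep.covariant
    exact ⟨lpPi ϑ, fun ξ η => Subtype.ext (funext fun i => h1 i ξ η),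
      fun a h => Subtype.ext (funext fun i => h2 i a h)⟩

theorem IsCovariantRepIn.codRestrict {D : Type u} [NonUnitalCStarAlgebra D]
    {φ : A →⋆ₙₐ[ℂ] D} {S : E →ₗ[ℂ] D} (h : IsCovariantRepIn φE φ S) :
    IsCovariantRepIn φE
      (codRestrictHom φ (generatedAlgebra φ S) (apply_mem_generatedAlgebra φ S))
      (codRestrictLinear S (generatedAlgebra φ S) (apply_mem_generatedAlgebra' φ S)) :=
  IsCovariantRepIn.of_comp_injective (i := inclusionHom _) Subtype.val_injective h

/-- A generating covariant representation whose seminorm on the free algebra dominates those of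
all covariant representations is universal. -/
theorem IsCovariantRepIn.isCuntzPimsnerAlgebra {O : Type u} [NonUnitalCStarAlgebra O]
    {φ₀ : A →⋆ₙₐ[ℂ] O} {S₀ : E →ₗ[ℂ] O} (h : IsCovariantRepIn φE φ₀ S₀)
    (hg : generatedAlgebra φ₀ S₀ = ⊤)
    (hle : ∀ (ρ : CovariantRep φE) x, ρ.seminorm x ≤ ‖freeHom φ₀ S₀ x‖) :
    IsCuntzPimsnerAlgebra φE φ₀ S₀ where
  isRep := h
  existsUnique D _ φ S hS := by
    obtain ⟨ψ, h1, h2⟩ := exists_hom_of_norm_freeHom_le φ₀ S₀ hg φ S (hle ⟨D, φ, S, hS⟩)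
    exact ⟨ψ, ⟨h1, h2⟩, fun ψ' h' => hom_ext_of_generatedAlgebra_eq_top hg
      (fun a => (h'.1 a).trans (h1 a).symm) (fun ξ => (h'.2 ξ).trans (h2 ξ).symm)⟩

variable (φE) in
-- Covariant representations form a type in the next universe, but only their seminorms on the free
-- algebra matter. One representation is chosen for each seminorm; the algebra generated in the
-- product of these choices dominates all of them.
theorem exists_isCuntzPimsnerAlgebra :
    ∃ (O : Type u) (_ : NonUnitalCStarAlgebra O) (φ₀ : A →⋆ₙₐ[ℂ] O) (S₀ : E →ₗ[ℂ] O),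
      IsCuntzPimsnerAlgebra φE φ₀ S₀ := by
  -- A set of real functions on a type in `Type u`, hence small enough to index a product.
  let ι : Type u := Set.range (CovariantRep.seminorm (φE := φE))
  let ρ : ι → CovariantRep φE := fun p => p.2.choose
  have hρ (p : ι) : (ρ p).seminorm = p := p.2.choose_spec
  have h := isCovariantRepIn_lpPi ρ
  set φ := lpPi fun i => (ρ i).φ
  set S := lpPiLinear (fun i => (ρ i).S) fun i => (ρ i).isRep.norm_apply_le
  refine ⟨generatedAlgebra φ S, inferInstance, _, _,
    h.codRestrict.isCuntzPimsnerAlgebra (generatedAlgebra_codRestrict φ S) fun σ x => ?_⟩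
  let p : ι := ⟨σ.seminorm, σ, rfl⟩
  -- The chosen representative need not be σ, but it has the same seminorm; it is a coordinate of
  -- the product, and coordinate projections are contractive.
  have h1 : σ.seminorm x = ‖freeHom (ρ p).φ (ρ p).S x‖ := congrFun (hρ p).symm x
  rw [h1]
  have h2 := compRep_freeHom
    (codRestrictHom φ (generatedAlgebra φ S) (apply_mem_generatedAlgebra φ S))
    (codRestrictLinear S (generatedAlgebra φ S) (apply_mem_generatedAlgebra' φ S))
    ((lpProj p).comp (inclusionHom (generatedAlgebra φ S))) x
  exact (congrArg norm h2).trans_le (NonUnitalStarAlgHom.norm_apply_le _ _)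

/-- Universality gives a map from O to the generated subalgebra; followed by the inclusion it fixes
the generators, so by uniqueness it is the identity, and the inclusion is onto. -/
theorem IsCuntzPimsnerAlgebra.generatedAlgebra_eq_top {O : Type u} [NonUnitalCStarAlgebra O]
    {φ₀ : A →⋆ₙₐ[ℂ] O} {S₀ : E →ₗ[ℂ] O} (h : IsCuntzPimsnerAlgebra φE φ₀ S₀) :
    generatedAlgebra φ₀ S₀ = ⊤ := by
  obtain ⟨ψ, ⟨h1, h2⟩, -⟩ := h.existsUnique _ _ _ h.isRep.codRestrict
  have h3 : (inclusionHom (generatedAlgebra φ₀ S₀)).comp ψ = NonUnitalStarAlgHom.id ℂ O :=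
    (h.existsUnique O φ₀ S₀ h.isRep).unique
      ⟨fun a => congrArg Subtype.val (h1 a), fun ξ => congrArg Subtype.val (h2 ξ)⟩
      ⟨fun _ => rfl, fun _ => rfl⟩
  rw [eq_top_iff]
  intro x _
  have h4 : ((ψ x : generatedAlgebra φ₀ S₀) : O) = x := congrArg (fun f : O →⋆ₙₐ[ℂ] O => f x) h3
  exact h4 ▸ (ψ x).2

end Existence

/-! ### Comparing the two universal properties -/

section Universal
variable {A E O : Type u} [NonUnitalCStarAlgebra A] [PartialOrder A] [StarOrderedRing A]
  [NormedAddCommGroup E] [NormedSpace ℂ E] [CompleteSpace E] [SMul Aᵐᵒᵖ E] [CStarModule Aᵐᵒᵖ E]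
  [NonUnitalCStarAlgebra O] [PartialOrder O] [StarOrderedRing O]
  {φE : A →⋆ₙₐ[ℂ] Adjointable A E E} {φ₀ : A →⋆ₙₐ[ℂ] O} {S₀ : E →ₗ[ℂ] O}

theorem IsNondegenerateAction.of_comp {B F : Type*} [NonUnitalCStarAlgebra B] [PartialOrder B]
    [StarOrderedRing B] [NormedAddCommGroup F] [NormedSpace ℂ F] [CompleteSpace F]
    [SMul Bᵐᵒᵖ F] [CStarModule Bᵐᵒᵖ F] {ψ : O →⋆ₙₐ[ℂ] Adjointable B F F}
    (h : IsNondegenerateAction (ψ.comp φ₀)) : IsNondegenerateAction ψ :=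
  h.mono (Submodule.span_mono (by rintro _ ⟨a, x, rfl⟩; exact ⟨φ₀ a, x, rfl⟩))

/-- Each ψ(x)η is a limit of sums of ψ(φ₀(a)y)η = ψ(φ₀(a))ψ(y)η, because φ₀(A)O spans a dense
subspace of O. -/
theorem IsNondegenerateAction.comp {B F : Type*} [NonUnitalCStarAlgebra B] [PartialOrder B]
    [StarOrderedRing B] [NormedAddCommGroup F] [NormedSpace ℂ F] [CompleteSpace F]
    [SMul Bᵐᵒᵖ F] [CStarModule Bᵐᵒᵖ F] {ψ : O →⋆ₙₐ[ℂ] Adjointable B F F}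
    (h : IsNondegenerateAction ψ) (h₀ : IsNondegenerateAction ((leftMul O).comp φ₀)) :
    IsNondegenerateAction (ψ.comp φ₀) := by
  refine dense_span_of_subset_closure h ?_
  rintro _ ⟨x, η, rfl⟩
  let N : Submodule ℂ F := (Submodule.span ℂ
    {y : F | ∃ (a : A) (x : F), y = (ψ.comp φ₀) a x}).topologicalClosure
  have hle : (Submodule.span ℂ {y : O | ∃ (a : A) (x : O),
      y = ((leftMul O).comp φ₀) a x}).topologicalClosure
      ≤ N.comap ((Adjointable.applyCLM (B := B) (G := F) η).toLinearMap.comp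
        (ψ : O →ₗ[ℂ] Adjointable B F F)) := by
    refine Submodule.topologicalClosure_minimal _ (Submodule.span_le.mpr ?_)
      ((Submodule.isClosed_topologicalClosure _).preimage
        ((Adjointable.applyCLM η).continuous.comp (map_continuous ψ)))
    rintro _ ⟨a, x, rfl⟩
    change ψ (φ₀ a * x) η ∈ N
    rw [map_mul]
    exact Submodule.le_topologicalClosure _ (Submodule.subset_span ⟨a, ψ x η, rfl⟩)
  exact hle (h₀ x)

/-- A nondegenerate representation on F is a covariant representation in the C⋆-algebra 𝔹(F), so ψ
exists and is unique; properness gives the way back from covariant to nondegenerate. -/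
theorem IsCuntzPimsnerAlgebra.isUniversalNondegenerateRep (hE : IsNondegenerateAction φE)
    (hp : IsProper φE) (h : IsCuntzPimsnerAlgebra φE φ₀ S₀) :
    IsUniversalNondegenerateRep φE φ₀ S₀ := by
  have h₀ := h.isRep.isNondegenerateAction hE h.generatedAlgebra_eq_top
  have h₁ := h.isRep.comp (leftMul O)
  refine ⟨h₀, h₁.isRepresentation, h₁.isNondegenerateRep hp h₀, ?_, ?_⟩
  · intro B F _ _ _ _ _ _ _ _ φ S hφ hS hn
    obtain ⟨ψ, ⟨h2, h3⟩, h4⟩ := h.existsUnique _ φ S (hS.isCovariantRepIn hn)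
    refine ⟨ψ, ⟨?_, h2, h3⟩, fun ψ' h' => h4 ψ' h'.2⟩
    have h5 : ψ.comp φ₀ = φ := NonUnitalStarAlgHom.ext h2
    exact IsNondegenerateAction.of_comp (φ₀ := φ₀) (h5 ▸ hφ)
  · intro B F _ _ _ _ _ _ _ _ ψ hψ
    have h2 := h.isRep.comp ψ
    have h3 := hψ.comp h₀
    exact ⟨h3, h2.isRepresentation, h2.isNondegenerateRep hp h3⟩

namespace IsUniversalNondegenerateRep

theorem isCovariantRepIn (h : IsUniversalNondegenerateRep φE φ₀ S₀) :
    IsCovariantRepIn φE φ₀ S₀ :=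
  .of_comp_injective leftMul_injective (h.isRep.isCovariantRepIn h.nondegenerate_rep)

variable {T : Type u} [NonUnitalCStarAlgebra T] [PartialOrder T] [StarOrderedRing T]
  {φ : A →⋆ₙₐ[ℂ] T} {S : E →ₗ[ℂ] T}

/-- T is viewed as a Hilbert module over itself, on which (φ, S) acts nondegenerately because it
generates T. At this stage the homomorphism reaches only the multipliers 𝔹(T). -/
theorem exists_hom_adjointable (h : IsUniversalNondegenerateRep φE φ₀ S₀)
    (hE : IsNondegenerateAction φE) (hp : IsProper φE) (hS : IsCovariantRepIn φE φ S)
    (hg : generatedAlgebra φ S = ⊤) :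
    ∃ ψ : O →⋆ₙₐ[ℂ] Adjointable T T T, (∀ a, ψ (φ₀ a) = leftMul T (φ a)) ∧
      ∀ ξ, ψ (S₀ ξ) = leftMul T (S ξ) := by
  have h1 := hS.isNondegenerateAction hE hg
  have h2 := hS.comp (leftMul T)
  obtain ⟨ψ, ⟨-, h3, h4⟩, -⟩ := h.existsUnique T T _ _ h1 h2.isRepresentation
    (h2.isNondegenerateRep hp h1)
  exact ⟨ψ, h3, h4⟩

/-- Universality gives ψ : O → 𝔹(T), and multipliers of T act on O through θ. By uniqueness θ ∘ ψ is
left multiplication, so O multiplies i(T) into itself. Hence i(T) is a closed ideal, and it contains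
the dense span of φ₀(A)O, where φ₀ = i ∘ φ. -/
theorem surjective_of_generatedAlgebra_eq_top {i : T →⋆ₙₐ[ℂ] O}
    (h : IsUniversalNondegenerateRep φE (i.comp φ) (compRep i S))
    (hi : Function.Injective i) (hE : IsNondegenerateAction φE) (hp : IsProper φE)
    (hg : generatedAlgebra φ S = ⊤) : Function.Surjective i := by
  have hS : IsCovariantRepIn φE φ S := .of_comp_injective hi h.isCovariantRepIn
  obtain ⟨ψ, hψ, hψ'⟩ := h.exists_hom_adjointable hE hp hS hg
  -- T is treated as a correspondence over itself, represented on O; extending i to multipliers is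
  -- then an instance of `exists_adjointable_hom`.
  let R : T →ₗ[ℂ] Adjointable O O O := compRep (leftMul O) (i : T →ₗ[ℂ] O)
  have hR : IsRepresentation (leftMul T) ((leftMul O).comp i) ((leftMul O).comp i) R :=
    { map_left := fun a x => by
        change leftMul O (i (a * x)) = leftMul O (i a) * leftMul O (i x)
        rw [map_mul, map_mul]
      adjoint_comp := fun x y => by
        change star (leftMul O (i x)) * leftMul O (i y) = leftMul O (i (star x * y))
        rw [map_mul, map_mul, map_star, map_star] }
  have hRn : IsNondegenerateRep R :=
    h.nondegenerate_action.mono (Submodule.span_mono (by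
      rintro _ ⟨a, x, rfl⟩; exact ⟨φ a, x, rfl⟩))
  obtain ⟨θ, hθ⟩ := hR.exists_adjointable_hom hRn
  have hgen (t : T) : θ (leftMul T t) = leftMul O (i t) := by
    refine Adjointable.eq_of_eqOn_span hRn ?_
    rintro _ ⟨s, x, rfl⟩
    rw [hθ]
    change i (t * s) * x = i t * (i s * x)
    rw [map_mul, mul_assoc]
  have hφ (a : A) : (θ.comp ψ) ((i.comp φ) a) = ((leftMul O).comp (i.comp φ)) a :=
    (congrArg θ (hψ a)).trans (hgen _)
  have hSξ (ξ : E) : (θ.comp ψ) (compRep i S ξ) = compRep (leftMul O) (compRep i S) ξ :=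
    (congrArg θ (hψ' ξ)).trans (hgen _)
  have hnd : IsNondegenerateAction (θ.comp ψ) := by
    have h5 : (θ.comp ψ).comp (i.comp φ) = (leftMul O).comp (i.comp φ) :=
      NonUnitalStarAlgHom.ext hφ
    exact IsNondegenerateAction.of_comp (φ₀ := i.comp φ) (h5 ▸ h.nondegenerate_action)
  have hθψ : θ.comp ψ = leftMul O :=
    (h.existsUnique O O _ _ h.nondegenerate_action h.isRep h.nondegenerate_rep).unique
      ⟨hnd, hφ, hSξ⟩ ⟨isNondegenerateAction_leftMul, fun _ => rfl, fun _ => rfl⟩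
  -- The left ideal property, with an explicit preimage; taking adjoints yields the right ideal
  -- property.
  have hleft (o : O) (t : T) : o * i t = i (ψ o t) := by
    refine leftMul_injective (Adjointable.ext fun x => ?_)
    have h6 := congrArg (fun f : O →⋆ₙₐ[ℂ] Adjointable O O O => f o (R t x)) hθψ
    rw [leftMul_apply, mul_assoc]
    exact (h6.symm.trans (hθ (ψ o) t x))
  have hright (t : T) (o : O) : i t * o ∈ Set.range i :=
    ⟨star (ψ (star o) (star t)), by rw [map_star, ← hleft, map_star, star_mul, star_star, star_star]⟩
  intro o
  have hle : (Submodule.span ℂ {y : O | ∃ (a : A) (x : O),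
      y = ((leftMul O).comp (i.comp φ)) a x}).topologicalClosure
      ≤ LinearMap.range (i : T →ₗ[ℂ] O) := by
    refine Submodule.topologicalClosure_minimal _ (Submodule.span_le.mpr ?_)
      (i.isClosed_range_of_injective hi)
    rintro _ ⟨a, x, rfl⟩
    exact hright (φ a) x
  exact hle (h.nondegenerate_action o)

theorem generatedAlgebra_eq_top (h : IsUniversalNondegenerateRep φE φ₀ S₀)
    (hE : IsNondegenerateAction φE) (hp : IsProper φE) : generatedAlgebra φ₀ S₀ = ⊤ := by
  let _ : PartialOrder (generatedAlgebra φ₀ S₀) := CStarAlgebra.spectralOrder _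
  have _ : StarOrderedRing (generatedAlgebra φ₀ S₀) := CStarAlgebra.spectralOrderedRing _
  have hs : Function.Surjective (inclusionHom (generatedAlgebra φ₀ S₀)) :=
    surjective_of_generatedAlgebra_eq_top
      (φ := codRestrictHom φ₀ _ (apply_mem_generatedAlgebra φ₀ S₀))
      (S := codRestrictLinear S₀ _ (apply_mem_generatedAlgebra' φ₀ S₀)) h
      Subtype.val_injective hE hp (generatedAlgebra_codRestrict φ₀ S₀)
  rw [eq_top_iff]
  intro x _
  obtain ⟨y, rfl⟩ := hs x
  exact y.2

/-- Since O is generated by φ₀ and S₀, whose images land in the closed copy of T in 𝔹(T), the whole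
of O is mapped into T. -/
theorem exists_hom (h : IsUniversalNondegenerateRep φE φ₀ S₀)
    (hE : IsNondegenerateAction φE) (hp : IsProper φE) (hS : IsCovariantRepIn φE φ S)
    (hg : generatedAlgebra φ S = ⊤) :
    ∃ ψ : O →⋆ₙₐ[ℂ] T, (∀ a, ψ (φ₀ a) = φ a) ∧ ∀ ξ, ψ (S₀ ξ) = S ξ := by
  obtain ⟨ψ, hψ, hψ'⟩ := h.exists_hom_adjointable hE hp hS hg
  obtain ⟨ψ', h1⟩ := (leftMul T).exists_lift_of_injective leftMul_injective ψ
    (map_mem_of_generatedAlgebra_eq_top (h.generatedAlgebra_eq_top hE hp)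
      (T := NonUnitalStarAlgHom.range (leftMul T))
      ((leftMul T).isClosed_range_of_injective leftMul_injective)
      (fun a => ⟨φ a, (hψ a).symm⟩) fun ξ => ⟨S ξ, (hψ' ξ).symm⟩)
  exact ⟨ψ', fun a => leftMul_injective (by rw [h1, hψ]),
    fun ξ => leftMul_injective (by rw [h1, hψ'])⟩

theorem isCuntzPimsnerAlgebra (h : IsUniversalNondegenerateRep φE φ₀ S₀)
    (hE : IsNondegenerateAction φE) (hp : IsProper φE) : IsCuntzPimsnerAlgebra φE φ₀ S₀ where
  isRep := h.isCovariantRepIn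
  existsUnique D _ φ S hS := by
    -- D carries no chosen order; the spectral one makes the generated subalgebra a Hilbert module
    -- over itself.
    let _ : PartialOrder (generatedAlgebra φ S) := CStarAlgebra.spectralOrder _
    have _ : StarOrderedRing (generatedAlgebra φ S) := CStarAlgebra.spectralOrderedRing _
    obtain ⟨ψ, h1, h2⟩ := h.exists_hom hE hp hS.codRestrict (generatedAlgebra_codRestrict φ S)
    have h3 (a : A) : (inclusionHom _).comp ψ (φ₀ a) = φ a := congrArg Subtype.val (h1 a)
    have h4 (ξ : E) : (inclusionHom _).comp ψ (S₀ ξ) = S ξ := congrArg Subtype.val (h2 ξ)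
    exact ⟨(inclusionHom _).comp ψ, ⟨h3, h4⟩, fun ψ' h' =>
      hom_ext_of_generatedAlgebra_eq_top (h.generatedAlgebra_eq_top hE hp)
        (fun a => (h'.1 a).trans (h3 a).symm) fun ξ => (h'.2 ξ).trans (h4 ξ).symm⟩

end IsUniversalNondegenerateRep

/-! ### Representations versus transformations -/

section Transformation
variable {u₀ : CorrespondenceIso (tensorAction φE ((leftMul O).comp φ₀)) ((leftMul O).comp φ₀)}

/-- On ξ ⊗ ψ(x)η the two sides are S(ξ)ψ(x)η and ψ(S₀(ξ))ψ(x)η. The vectors ψ(x)η span a dense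
subspace, so S(ξ) = ψ(S₀(ξ)) can be recovered; the two notions of universality become translations
of each other. -/
theorem isInducedTransformation_iff
    (hu₀ : ∀ ξ x, u₀ (InteriorTensor.tmul _ ξ x) = S₀ ξ * x)
    {B F : Type u} [NonUnitalCStarAlgebra B] [PartialOrder B] [StarOrderedRing B]
    [NormedAddCommGroup F] [NormedSpace ℂ F] [CompleteSpace F] [SMul Bᵐᵒᵖ F] [CStarModule Bᵐᵒᵖ F]
    {ψ : O →⋆ₙₐ[ℂ] Adjointable B F F} (hψ : IsNondegenerateAction ψ)
    {φ : A →⋆ₙₐ[ℂ] Adjointable B F F} {S : E →ₗ[ℂ] Adjointable B F F}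
    {u : CorrespondenceIso (tensorAction φE φ) φ}
    (hu : ∀ ξ η, u (InteriorTensor.tmul φ ξ η) = S ξ η) :
    IsInducedTransformation u₀ ψ u ↔ ∀ ξ, ψ (S₀ ξ) = S ξ := by
  refine ⟨fun h ξ => (eq_of_isNondegenerateAction hψ fun x η => ?_).symm, fun h ξ x η => ?_⟩
  · rw [← hu, h, hu₀, map_mul]
    rfl
  · rw [hu, hu₀, map_mul, h]
    rfl

theorem IsUniversalNondegenerateRep.isUniversalTransformation
    (h : IsUniversalNondegenerateRep φE φ₀ S₀)
    (hu₀ : ∀ ξ x, u₀ (InteriorTensor.tmul _ ξ x) = S₀ ξ * x) :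
    IsUniversalTransformation φE φ₀ u₀ where
  nondegenerate_action := h.nondegenerate_action
  existsUnique B F _ _ _ _ _ _ _ _ φ u hφ := by
    obtain ⟨ψ, ⟨h1, h2, h3⟩, h4⟩ := h.existsUnique B F φ u.toRep hφ u.isRepresentation_toRep
      (u.isNondegenerateRep_of_forall_tmul fun ξ x => rfl)
    refine ⟨ψ, ⟨h1, h2, (isInducedTransformation_iff hu₀ h1 (S := u.toRep) fun _ _ => rfl).mpr h3⟩, ?_⟩
    rintro ψ' ⟨h1', h2', h3'⟩
    exact h4 ψ' ⟨h1', h2', (isInducedTransformation_iff hu₀ h1' (S := u.toRep) fun _ _ => rfl).mp h3'⟩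
  comp B F _ _ _ _ _ _ _ _ ψ hψ := by
    obtain ⟨h1, h2, h3⟩ := h.comp B F ψ hψ
    obtain ⟨u, hu⟩ := h2.exists_correspondenceIso h3
    refine ⟨h1, u, (isInducedTransformation_iff hu₀ hψ hu).mpr fun ξ => rfl, fun v hv => ?_⟩
    have hv' := (isInducedTransformation_iff hu₀ hψ (S := v.toRep) fun _ _ => rfl).mp hv
    refine CorrespondenceIso.toAdjointable_injective (Adjointable.toCLM_injective
      (InteriorTensor.eqOn_tmul fun ξ x => ?_))
    change v _ = u _
    rw [hu, ← v.toRep_apply, ← hv']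
    rfl

theorem IsUniversalTransformation.isUniversalNondegenerateRep
    (h : IsUniversalTransformation φE φ₀ u₀)
    (hu₀ : ∀ ξ x, u₀ (InteriorTensor.tmul _ ξ x) = S₀ ξ * x) :
    IsUniversalNondegenerateRep φE φ₀ S₀ := by
  have hS₀ : u₀.toRep = compRep (leftMul O) S₀ :=
    LinearMap.ext fun ξ => Adjointable.ext fun x => hu₀ ξ x
  have hrep : IsRepresentation φE ((leftMul O).comp φ₀) ((leftMul O).comp φ₀)
      (compRep (leftMul O) S₀) := hS₀ ▸ u₀.isRepresentation_toRep
  refine ⟨h.nondegenerate_action, hrep, u₀.isNondegenerateRep_of_forall_tmul hu₀, ?_, ?_⟩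
  · intro B F _ _ _ _ _ _ _ _ φ S hφ hS hn
    obtain ⟨u, hu⟩ := hS.exists_correspondenceIso hn
    obtain ⟨ψ, ⟨h1, h2, h3⟩, h4⟩ := h.existsUnique B F φ u hφ
    refine ⟨ψ, ⟨h1, h2, (isInducedTransformation_iff hu₀ h1 hu).mp h3⟩, ?_⟩
    rintro ψ' ⟨h1', h2', h3'⟩
    exact h4 ψ' ⟨h1', h2', (isInducedTransformation_iff hu₀ h1' hu).mpr h3'⟩
  · intro B F _ _ _ _ _ _ _ _ ψ hψ
    obtain ⟨h1, u, hu, -⟩ := h.comp B F ψ hψ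
    have hS : u.toRep = compRep ψ S₀ := LinearMap.ext fun ξ =>
      ((isInducedTransformation_iff hu₀ hψ (S := u.toRep) fun _ _ => rfl).mp hu ξ).symm
    exact ⟨h1, hS ▸ u.isRepresentation_toRep,
      hS ▸ u.isNondegenerateRep_of_forall_tmul fun ξ x => rfl⟩

/-- A transformation `u₀ : E ⊗_A O ≅ O` comes from a map `E → O`. -/
theorem CorrespondenceIso.exists_linearMap (hE : IsNondegenerateAction φE)
    (u₀ : CorrespondenceIso (tensorAction φE ((leftMul O).comp φ₀)) ((leftMul O).comp φ₀)) :
    ∃ S₀ : E →ₗ[ℂ] O, ∀ ξ x, u₀ (InteriorTensor.tmul _ ξ x) = S₀ ξ * x := by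
  have hrep := u₀.isRepresentation_toRep
  have hmem (ξ : E) : u₀.toRep ξ ∈ LinearMap.range (leftMul O : O →ₗ[ℂ] Adjointable O O O) := by
    -- For ξ replaced by aξ the operator is φ₀(a) times a multiplier of O, hence in the ideal O. The
    -- copy of O is closed and AE spans a dense subspace, so every ξ is reached.
    have hle : (Submodule.span ℂ {y : E | ∃ (a : A) (x : E), y = φE a x}).topologicalClosure
        ≤ (LinearMap.range (leftMul O : O →ₗ[ℂ] Adjointable O O O)).comap u₀.toRep := by
      refine Submodule.topologicalClosure_minimal _ (Submodule.span_le.mpr ?_)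
        (((leftMul O).isClosed_range_of_injective leftMul_injective).preimage
          (AddMonoidHomClass.continuous_of_bound u₀.toRep 1 fun ξ => by
            rw [one_mul]; exact hrep.norm_apply_le ξ))
      rintro _ ⟨a, ξ, rfl⟩
      exact ⟨_, ((hrep.map_left a ξ).trans (leftMul_comp (φ₀ a) _)).symm⟩
    exact hle (hE ξ)
  choose S hS using hmem
  have hS' (ξ : E) : leftMul O (S ξ) = u₀.toRep ξ := hS ξ
  refine ⟨{ toFun := S, map_add' := fun ξ η => leftMul_injective ?_,
            map_smul' := fun z ξ => leftMul_injective ?_ }, fun ξ x => ?_⟩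
  · rw [map_add, hS', hS', hS', map_add]
  · rw [map_smul, hS', hS', map_smul, RingHom.id_apply]
  · exact congrArg (fun T : Adjointable O O O => T x) (hS' ξ).symm

end Transformation
end Universal

end

/-! ### The proposition -/

theorem mainTheorem2 :
    (∀ (A B₁ B₂ E F₁ F₂ : Type*)
      [NonUnitalCStarAlgebra A]
      [NonUnitalCStarAlgebra B₁] [PartialOrder B₁] [StarOrderedRing B₁]
      [NonUnitalCStarAlgebra B₂] [PartialOrder B₂] [StarOrderedRing B₂]
      [NormedAddCommGroup E] [NormedSpace ℂ E] [CompleteSpace E]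
      [SMul B₁ᵐᵒᵖ E] [CStarModule B₁ᵐᵒᵖ E]
      [NormedAddCommGroup F₁] [NormedSpace ℂ F₁] [CompleteSpace F₁]
      [SMul B₂ᵐᵒᵖ F₁] [CStarModule B₂ᵐᵒᵖ F₁]
      [NormedAddCommGroup F₂] [NormedSpace ℂ F₂] [CompleteSpace F₂]
      [SMul B₂ᵐᵒᵖ F₂] [CStarModule B₂ᵐᵒᵖ F₂]
      (φE : A →⋆ₙₐ[ℂ] Adjointable B₁ E E) (φ₁ : B₁ →⋆ₙₐ[ℂ] Adjointable B₂ F₁ F₁)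
      (φ₂ : A →⋆ₙₐ[ℂ] Adjointable B₂ F₂ F₂) (S : E →ₗ[ℂ] Adjointable B₂ F₁ F₂),
      IsNondegenerateAction φE → IsNondegenerateAction φ₁ → IsNondegenerateAction φ₂ →
      IsRepresentation φE φ₁ φ₂ S →
        (IsNondegenerateRep S → IsCuntzPimsnerCovariant φE φ₂ S) ∧
        (IsProper φE → IsCuntzPimsnerCovariant φE φ₂ S → IsNondegenerateRep S)) ∧
    (∀ (A E : Type u) [NonUnitalCStarAlgebra A] [PartialOrder A] [StarOrderedRing A]
      [NormedAddCommGroup E] [NormedSpace ℂ E] [CompleteSpace E]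
      [SMul Aᵐᵒᵖ E] [CStarModule Aᵐᵒᵖ E] (φE : A →⋆ₙₐ[ℂ] Adjointable A E E),
      IsNondegenerateAction φE → IsProper φE →
        (∃ (O : Type u) (_ : NonUnitalCStarAlgebra O) (φ₀ : A →⋆ₙₐ[ℂ] O) (S₀ : E →ₗ[ℂ] O),
          IsCuntzPimsnerAlgebra φE φ₀ S₀) ∧
        ∀ (O : Type u) [NonUnitalCStarAlgebra O] [PartialOrder O] [StarOrderedRing O]
          (φ₀ : A →⋆ₙₐ[ℂ] O),
          (∀ S₀ : E →ₗ[ℂ] O,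
            IsCuntzPimsnerAlgebra φE φ₀ S₀ ↔ IsUniversalNondegenerateRep φE φ₀ S₀) ∧
          (∀ S₀ : E →ₗ[ℂ] O, IsCuntzPimsnerAlgebra φE φ₀ S₀ →
            ∃ u₀ : CorrespondenceIso (tensorAction φE ((leftMul O).comp φ₀))
                ((leftMul O).comp φ₀),
              (∀ ξ x, u₀ (InteriorTensor.tmul _ ξ x) = S₀ ξ * x) ∧
              IsUniversalTransformation φE φ₀ u₀) ∧
          (∀ u₀ : CorrespondenceIso (tensorAction φE ((leftMul O).comp φ₀))
              ((leftMul O).comp φ₀),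
            IsUniversalTransformation φE φ₀ u₀ →
              ∃ S₀ : E →ₗ[ℂ] O,
                (∀ ξ x, u₀ (InteriorTensor.tmul _ ξ x) = S₀ ξ * x) ∧
                IsCuntzPimsnerAlgebra φE φ₀ S₀)) := by
  refine ⟨?_, ?_⟩
  · intro A B₁ B₂ E F₁ F₂ _ _ _ _ _ _ _ _ _ _ _ _ _ _ _ _ _ _ _ _ _ _ φE φ₁ φ₂ S _ _ h₂ hS
    exact ⟨hS.isCuntzPimsnerCovariant, fun hp hc => hc.isNondegenerateRep h₂ hp⟩
  · intro A E _ _ _ _ _ _ _ _ φE hE hp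
    refine ⟨exists_isCuntzPimsnerAlgebra φE, ?_⟩
    intro O _ _ _ φ₀
    refine ⟨fun S₀ => ⟨fun h => h.isUniversalNondegenerateRep hE hp,
      fun h => h.isCuntzPimsnerAlgebra hE hp⟩, fun S₀ h => ?_, fun u₀ h => ?_⟩
    · have h' := h.isUniversalNondegenerateRep hE hp
      obtain ⟨u₀, hu₀⟩ := h'.isRep.exists_correspondenceIso h'.nondegenerate_rep
      exact ⟨u₀, hu₀, h'.isUniversalTransformation hu₀⟩
    · obtain ⟨S₀, hu₀⟩ := u₀.exists_linearMap hE
      exact ⟨S₀, hu₀, (h.isUniversalNondegenerateRep hu₀).isCuntzPimsnerAlgebra hE hp⟩
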